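/- Let $(A_i)_{i\ge 0}$ (inter-arrival times) and $(X_i)_{i\ge 0}$ (energy packet sizes) be two sequences of random variables, each i.i.d. and independent of one another, with $P(A_i\le 0)=P(X_i\le 0)=0$, $E[A_i]<\infty$, $E[X_i]<\infty$, and with $X_i$ continuous (its law has no atoms). Let $p>0$ be the constant consumption rate, let $t_n=\sum_{i<n}A_i$, let $N(t)$ be the number of $n\ge 1$ with $t_n\le t$, and for initial battery energy $u_0$ let $$U(t)=u_0-pt+\sum_{i=0}^{N(t)}X_i ,\qquad \tau=\inf\{t>0: U(t)\le 0\},\qquad \psi(u_0)=P(\tau<\infty)$$ (with $\inf\emptyset=\infty$), so that $\psi(u_0)$ is the eventual outage probability. Put $Z_i=pA_i-X_i$, $S_n=\sum_{i<n}Z_i$, $\sigma=\inf\{n\ge 1: S_n>0\}$, and let $H=S_\sigma$ on $\{\sigma<\infty\}$ be the first strict ascending ladder height, with (possibly defective) law $F_H(B)=P(\sigma<\infty,\ H\in B)$ and total mass $\theta=P(\sigma<\infty)$. A number $r\ne 0$ is called an adjustment coefficient of a (possibly defective) law $F$ on $\mathbb R$ if $\int e^{rx}\,dF(x)=1$. Assume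 the self-sustainability condition $\lambda E[X_0]>p$, where $\lambda=1/E[A_0]$. Then: 1. If $r^*$ is an adjustment coefficient of $F_H$ and $\tilde\mu_H=\int x e^{r^*x}\,dF_H(x)<\infty$, then $$\psi(u_0)\sim\frac{1-\theta}{r^*\tilde\mu_H}\,e^{-r^*u_0}\qquad (u_0\to\infty).$$ 2. If the law of $X_0$ has a Lebesgue density, then so has $F_H$; with $f_H$ its density, $\tilde\mu_H=\int x e^{r^*x}f_H(x)\,dx$. 3. A real number is an adjustment coefficient of $F_H$ if and only if it is an adjustment coefficient of the law of $Z_0$. -/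

import Mathlib

namespace HSC

open MeasureTheory ProbabilityTheory

noncomputable section

variable {Ω : Type*}

/-- Standing assumptions of the harvest-store-consume model with infinite battery: `A i` are the
inter-arrival times, `X i` the packet sizes and `p` is the constant consumption rate. A continuous
random variable is one whose law has no atoms, i.e. whose distribution function is continuous. -/
structure IsModel [MeasurableSpace Ω] (P : Measure Ω) (A X : ℕ → Ω → ℝ) (p : ℝ) : Prop where
  rate_pos : 0 < p
  measurable_A : ∀ i, Measurable (A i)
  indep_A : iIndepFun A P
  ident_A : ∀ i, IdentDistrib (A i) (A 0) P P
  pos_A : ∀ i, P {ω | A i ω ≤ 0} = 0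
  integrable_A : Integrable (A 0) P
  measurable_X : ∀ i, Measurable (X i)
  indep_X : iIndepFun X P
  ident_X : ∀ i, IdentDistrib (X i) (X 0) P P
  pos_X : ∀ i, P {ω | X i ω ≤ 0} = 0
  continuous_X : ∀ x : ℝ, P {ω | X 0 ω = x} = 0
  integrable_X : Integrable (X 0) P
  indep_A_X : IndepFun (fun ω i => A i ω) (fun ω i => X i ω) P

/-- The arrival rate `λ = 1 / E[A]`. -/
def arrivalRate [MeasurableSpace Ω] (P : Measure Ω) (A : ℕ → Ω → ℝ) : ℝ := 1 / ∫ ω, A 0 ω ∂P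

/-- The self-sustainability condition `λ * E[X] > p`. -/
def SelfSustainable [MeasurableSpace Ω] (P : Measure Ω) (A X : ℕ → Ω → ℝ) (p : ℝ) : Prop :=
  p < arrivalRate P A * ∫ ω, X 0 ω ∂P

/-- The arrival times `t_0 = 0`, `t_n = A_0 + ⋯ + A_{n-1}`. -/
def arrivalTime (A : ℕ → Ω → ℝ) (n : ℕ) (ω : Ω) : ℝ := ∑ i ∈ Finset.range n, A i ω

/-- `N(t)`, the number of arrivals in `(0, t]` (the packet at time `0` is not counted). -/
def arrivalCount (A : ℕ → Ω → ℝ) (t : ℝ) (ω : Ω) : ℕ :=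
  {n : ℕ | 1 ≤ n ∧ arrivalTime A n ω ≤ t}.ncard

/-- The energy surplus `U(t) = u₀ - p t + ∑_{i=0}^{N(t)} X_i`. -/
def surplus (A X : ℕ → Ω → ℝ) (p u₀ t : ℝ) (ω : Ω) : ℝ :=
  u₀ - p * t + ∑ i ∈ Finset.range (arrivalCount A t ω + 1), X i ω

/-- The first time to outage `τ = inf {t > 0 : U(t) ≤ 0}`, equal to `⊤` if there is no outage. -/
def outageTime (A X : ℕ → Ω → ℝ) (p u₀ : ℝ) (ω : Ω) : EReal :=
  sInf {s : EReal | ∃ t : ℝ, 0 < t ∧ surplus A X p u₀ t ω ≤ 0 ∧ s = (t : EReal)}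

/-- The eventual outage probability `ψ(u₀) = P(τ < ∞)`. -/
def outageProb [MeasurableSpace Ω] (P : Measure Ω) (A X : ℕ → Ω → ℝ) (p u₀ : ℝ) : ℝ :=
  P.real {ω | outageTime A X p u₀ ω < ⊤}

/-- The increments `Z_i = p A_i - X_i`. -/
def increment (A X : ℕ → Ω → ℝ) (p : ℝ) (i : ℕ) (ω : Ω) : ℝ := p * A i ω - X i ω

/-- The random walk `S_n = Z_0 + ⋯ + Z_{n-1}`. -/
def walk (A X : ℕ → Ω → ℝ) (p : ℝ) (n : ℕ) (ω : Ω) : ℝ :=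
  ∑ i ∈ Finset.range n, increment A X p i ω

/-- The first strict ascending ladder epoch `σ = inf {n ≥ 1 : S_n > 0}`, possibly `⊤`. -/
def ladderEpoch (A X : ℕ → Ω → ℝ) (p : ℝ) (ω : Ω) : ℕ∞ :=
  sInf {k : ℕ∞ | ∃ n : ℕ, 1 ≤ n ∧ 0 < walk A X p n ω ∧ k = (n : ℕ∞)}

/-- The ladder height `H = S_σ`; only its values on `{σ < ∞}` matter. -/
def ladderHeight (A X : ℕ → Ω → ℝ) (p : ℝ) (ω : Ω) : ℝ :=
  walk A X p (ladderEpoch A X p ω).toNat ω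

/-- The (possibly defective) law of the ladder height: `B ↦ P(σ < ∞, H ∈ B)`. -/
def ladderHeightLaw [MeasurableSpace Ω] (P : Measure Ω) (A X : ℕ → Ω → ℝ) (p : ℝ) : Measure ℝ :=
  (P.restrict {ω | ladderEpoch A X p ω < ⊤}).map (ladderHeight A X p)

/-- `θ = F_H(∞)`, the total mass of the law of the ladder height. -/
def ladderMass [MeasurableSpace Ω] (P : Measure Ω) (A X : ℕ → Ω → ℝ) (p : ℝ) : ℝ :=
  (ladderHeightLaw P A X p).real Set.univ

/-- `f_H`, the Lebesgue density of the law of the ladder height. -/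
def ladderHeightDensity [MeasurableSpace Ω] (P : Measure Ω) (A X : ℕ → Ω → ℝ) (p x : ℝ) : ℝ :=
  ((ladderHeightLaw P A X p).rnDeriv volume x).toReal

/-- `∫ x e^{r x} dF_H(x)`. -/
def tiltedMean [MeasurableSpace Ω] (P : Measure Ω) (A X : ℕ → Ω → ℝ) (p r : ℝ) : ℝ :=
  ∫ x, x * Real.exp (r * x) ∂(ladderHeightLaw P A X p)

/-- `r ≠ 0` is an adjustment coefficient of a (possibly defective) law `ν` if
`∫ e^{r x} dν(x) = 1` (the integral being `1`, the integrand is integrable). -/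
def IsAdjustmentCoefficient (ν : Measure ℝ) (r : ℝ) : Prop :=
  r ≠ 0 ∧ ∫ x, Real.exp (r * x) ∂ν = 1

end

end HSC

namespace HSC

open MeasureTheory ProbabilityTheory Filter Topology
open scoped ENNReal

noncomputable section

/-! ### First passage of a random walk and the Markov property at a fixed time -/

section RandomWalk

variable {Ω : Type*}

/-- The partial sums `Z_0 + ⋯ + Z_{n-1}` of a sequence. -/
def partialSum (Z : ℕ → Ω → ℝ) (n : ℕ) (ω : Ω) : ℝ := ∑ i ∈ Finset.range n, Z i ω

/-- The event that the partial sums become positive for the first time at index `k`. -/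
def firstPassage (Z : ℕ → Ω → ℝ) (k : ℕ) : Set Ω :=
  {ω | (∀ j < k, partialSum Z j ω ≤ 0) ∧ 0 < partialSum Z k ω}

/-- The event that the partial sums stay nonpositive up to index `k`. -/
def noPassage (Z : ℕ → Ω → ℝ) (k : ℕ) : Set Ω := {ω | ∀ j ≤ k, partialSum Z j ω ≤ 0}

/-- The event that some partial sum exceeds the level `u`. -/
def exceeds (Z : ℕ → Ω → ℝ) (u : ℝ) : Set Ω := {ω | ∃ n, u < partialSum Z n ω}

/-- The coordinate process on the space of real sequences. -/
def coord (i : ℕ) (x : ℕ → ℝ) : ℝ := x i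

/-- The sequence frozen to zero from index `k` on. -/
def past (Z : ℕ → Ω → ℝ) (k : ℕ) (ω : Ω) : ℕ → ℝ := fun i => if i < k then Z i ω else 0

/-- The sequence shifted by `k`. -/
def future (Z : ℕ → Ω → ℝ) (k : ℕ) (ω : Ω) : ℕ → ℝ := fun i => Z (k + i) ω

lemma partialSum_coord_past (Z : ℕ → Ω → ℝ) {j k : ℕ} (h : j ≤ k) (ω : Ω) :
    partialSum coord j (past Z k ω) = partialSum Z j ω := by
  refine Finset.sum_congr rfl fun i hi => ?_
  rw [Finset.mem_range] at hi
  simp [coord, past, hi.trans_le h]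

lemma partialSum_coord_future (Z : ℕ → Ω → ℝ) (k m : ℕ) (ω : Ω) :
    partialSum coord m (future Z k ω) = partialSum Z (k + m) ω - partialSum Z k ω := by
  simp only [partialSum, Finset.sum_range_add, coord, future]
  ring

lemma partialSum_zero (Z : ℕ → Ω → ℝ) (ω : Ω) : partialSum Z 0 ω = 0 := by simp [partialSum]

lemma partialSum_succ (Z : ℕ → Ω → ℝ) (n : ℕ) (ω : Ω) :
    partialSum Z (n + 1) ω = partialSum Z n ω + Z n ω := by
  simp [partialSum, Finset.sum_range_succ]

/-- First passage at `k` is determined by the frozen sequence, which makes it an event on sequence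
space to which the independence of past and future applies. -/
lemma past_mem_firstPassage {Z : ℕ → Ω → ℝ} {k : ℕ} {ω : Ω} :
    past Z k ω ∈ firstPassage coord k ↔ ω ∈ firstPassage Z k := by
  simp only [firstPassage, Set.mem_ofPred_eq, partialSum_coord_past Z le_rfl]
  refine and_congr_left fun _ => forall₂_congr fun j hj => ?_
  rw [partialSum_coord_past Z hj.le]

lemma past_mem_noPassage {Z : ℕ → Ω → ℝ} {k : ℕ} {ω : Ω} :
    past Z k ω ∈ noPassage coord k ↔ ω ∈ noPassage Z k := by
  simp only [noPassage, Set.mem_ofPred_eq]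
  refine forall₂_congr fun j hj => ?_
  rw [partialSum_coord_past Z hj]

lemma firstPassage_zero (Z : ℕ → Ω → ℝ) : firstPassage Z 0 = ∅ := by
  ext ω; simp [firstPassage, partialSum_zero]

lemma noPassage_zero (Z : ℕ → Ω → ℝ) : noPassage Z 0 = Set.univ := by
  ext ω; simp [noPassage, partialSum_zero]

lemma noPassage_eq_union (Z : ℕ → Ω → ℝ) (k : ℕ) :
    noPassage Z k = noPassage Z (k + 1) ∪ firstPassage Z (k + 1) := by
  ext ω
  simp only [noPassage, firstPassage, Set.mem_ofPred_eq, Set.mem_union, Nat.lt_succ_iff]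
  constructor
  · intro h
    rcases le_or_gt (partialSum Z (k + 1) ω) 0 with h1 | h1
    · left
      intro j hj
      rcases Nat.le_succ_iff.1 hj with h2 | rfl
      exacts [h j h2, h1]
    · exact Or.inr ⟨h, h1⟩
  · rintro (h | h)
    exacts [fun j hj => h j (hj.trans k.le_succ), h.1]

lemma disjoint_noPassage_firstPassage (Z : ℕ → Ω → ℝ) (k : ℕ) :
    Disjoint (noPassage Z k) (firstPassage Z k) :=
  Set.disjoint_left.2 fun _ h1 h2 => (h1 k le_rfl).not_gt h2.2

lemma pairwise_disjoint_firstPassage (Z : ℕ → Ω → ℝ) :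
    Pairwise (Function.onFun Disjoint (firstPassage Z)) := by
  intro i j hij
  refine Set.disjoint_left.2 fun ω hi hj => ?_
  rcases hij.lt_or_gt with h | h
  · exact (hj.1 i h).not_gt hi.2
  · exact (hi.1 j h).not_gt hj.2

lemma exists_mem_firstPassage {Z : ℕ → Ω → ℝ} {ω : Ω} {n : ℕ} (h : 0 < partialSum Z n ω) :
    ∃ k ≤ n, ω ∈ firstPassage Z k := by
  classical
  have hex : ∃ n, 0 < partialSum Z n ω := ⟨n, h⟩
  exact ⟨Nat.find hex, Nat.find_min' hex h,
    fun j hj => not_lt.1 (Nat.find_min hex hj), Nat.find_spec hex⟩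

lemma exceeds_antitone (Z : ℕ → Ω → ℝ) : Antitone (exceeds Z) :=
  fun _ _ h _ ⟨n, hn⟩ => ⟨n, h.trans_lt hn⟩

lemma exceeds_of_neg (Z : ℕ → Ω → ℝ) {u : ℝ} (hu : u < 0) : exceeds Z u = Set.univ :=
  Set.eq_univ_of_forall fun ω => ⟨0, by rwa [partialSum_zero]⟩

/-- Exceeding a level `u ≥ 0` splits at the first passage into the positive half-line. -/
lemma exceeds_eq_iUnion (Z : ℕ → Ω → ℝ) {u : ℝ} (hu : 0 ≤ u) :
    exceeds Z u =
      ⋃ k, firstPassage Z k ∩ {ω | future Z k ω ∈ exceeds coord (u - partialSum Z k ω)} := by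
  ext ω
  simp only [exceeds, Set.mem_iUnion, Set.mem_inter_iff, Set.mem_ofPred_eq,
    partialSum_coord_future]
  constructor
  · rintro ⟨n, hn⟩
    obtain ⟨k, hk, hω⟩ := exists_mem_firstPassage (hu.trans_lt hn)
    refine ⟨k, hω, n - k, ?_⟩
    rw [Nat.add_sub_cancel' hk]
    linarith
  · rintro ⟨k, -, m, hm⟩
    exact ⟨k + m, by linarith⟩

variable [MeasurableSpace Ω] {P : Measure Ω} {Z : ℕ → Ω → ℝ}

lemma measurable_coord (i : ℕ) : Measurable (coord i) := measurable_pi_apply i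

lemma measurable_partialSum (hZ : ∀ i, Measurable (Z i)) (n : ℕ) :
    Measurable (partialSum Z n) := by
  unfold partialSum; fun_prop

lemma measurableSet_firstPassage (hZ : ∀ i, Measurable (Z i)) (k : ℕ) :
    MeasurableSet (firstPassage Z k) := by
  have h : firstPassage Z k =
      (⋂ j, ⋂ (_ : j < k), partialSum Z j ⁻¹' Set.Iic 0) ∩ partialSum Z k ⁻¹' Set.Ioi 0 := by
    ext ω; simp [firstPassage]
  rw [h]
  exact (MeasurableSet.iInter fun j => MeasurableSet.iInter fun _ =>
    measurable_partialSum hZ j measurableSet_Iic).inter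
      (measurable_partialSum hZ k measurableSet_Ioi)

lemma measurableSet_noPassage (hZ : ∀ i, Measurable (Z i)) (k : ℕ) :
    MeasurableSet (noPassage Z k) := by
  have h : noPassage Z k = ⋂ j, ⋂ (_ : j ≤ k), partialSum Z j ⁻¹' Set.Iic 0 := by
    ext ω; simp [noPassage]
  rw [h]
  exact MeasurableSet.iInter fun j => MeasurableSet.iInter fun _ =>
    measurable_partialSum hZ j measurableSet_Iic

lemma measurableSet_exceeds (hZ : ∀ i, Measurable (Z i)) (u : ℝ) :
    MeasurableSet (exceeds Z u) := by
  have h : exceeds Z u = ⋃ n, partialSum Z n ⁻¹' Set.Ioi u := by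
    ext ω; simp [exceeds]
  rw [h]
  exact MeasurableSet.iUnion fun n => measurable_partialSum hZ n measurableSet_Ioi

lemma measurable_past (hZ : ∀ i, Measurable (Z i)) (k : ℕ) : Measurable (past Z k) := by
  refine measurable_pi_lambda _ fun i => ?_
  by_cases h : i < k
  · simpa [past, h] using hZ i
  · simp [past, h]

lemma measurable_future (hZ : ∀ i, Measurable (Z i)) (k : ℕ) : Measurable (future Z k) :=
  measurable_pi_lambda _ fun i => hZ (k + i)

/-- The two sequences are measurable with respect to the σ-algebras generated by disjoint sets of
indices; the frozen entries are constant. -/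
lemma indepFun_past_future (hZ : ∀ i, Measurable (Z i)) (hI : iIndepFun Z P) (k : ℕ) :
    IndepFun (past Z k) (future Z k) P := by
  have hd : Disjoint {i | i < k} {i | k ≤ i} :=
    Set.disjoint_left.2 fun i (h1 : i < k) (h2 : k ≤ i) => absurd h1 h2.not_gt
  have h := indep_iSup_of_disjoint (fun i => (hZ i).comap_le) hI.iIndep hd
  rw [IndepFun_iff_Indep]
  refine indep_of_indep_of_le_left (indep_of_indep_of_le_right h ?_) ?_
  · refine Measurable.comap_le (@measurable_pi_lambda _ _ _ (_) _ _ fun i => ?_)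
    have hle : MeasurableSpace.comap (Z (k + i)) inferInstance ≤
        ⨆ j ∈ {j | k ≤ j}, MeasurableSpace.comap (Z j) inferInstance :=
      le_iSup₂_of_le (k + i) (Nat.le_add_right k i) le_rfl
    exact (comap_measurable (Z (k + i))).mono hle le_rfl
  · refine Measurable.comap_le (@measurable_pi_lambda _ _ _ (_) _ _ fun i => ?_)
    by_cases hi : i < k
    · have hle : MeasurableSpace.comap (Z i) inferInstance ≤
          ⨆ j ∈ {j | j < k}, MeasurableSpace.comap (Z j) inferInstance :=
        le_iSup₂_of_le i hi le_rfl
      simpa [past, hi] using (comap_measurable (Z i)).mono hle le_rfl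
    · simp [past, hi]

/-- Both laws are infinite products with the same marginals. -/
lemma map_future (hZ : ∀ i, Measurable (Z i)) (hI : iIndepFun Z P)
    (hid : ∀ i, IdentDistrib (Z i) (Z 0) P P) (k : ℕ) :
    P.map (future Z k) = P.map (fun ω i => Z i ω) := by
  have h1 : iIndepFun (fun i => Z (k + i)) P := hI.precomp (g := fun i => k + i)
    (add_right_injective k)
  have e1 := h1.map_fun_eq_infinitePi_map fun i => hZ (k + i)
  have e2 := hI.map_fun_eq_infinitePi_map hZ
  change P.map (fun ω i => Z (k + i) ω) = _
  rw [e1, e2]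
  congr 1
  funext i
  rw [(hid (k + i)).map_eq, (hid i).map_eq]

/-- The Markov property at a fixed time. -/
lemma lintegral_past_future [IsProbabilityMeasure P] (hZ : ∀ i, Measurable (Z i))
    (hI : iIndepFun Z P) (hid : ∀ i, IdentDistrib (Z i) (Z 0) P P) (k : ℕ)
    {f : (ℕ → ℝ) × (ℕ → ℝ) → ℝ≥0∞} (hf : Measurable f) :
    ∫⁻ ω, f (past Z k ω, future Z k ω) ∂P =
      ∫⁻ ω, ∫⁻ ω', f (past Z k ω, fun i => Z i ω') ∂P ∂P := by
  have hp := measurable_past hZ k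
  have hq := measurable_future hZ k
  have hz : Measurable (fun ω i => Z i ω) := measurable_pi_lambda _ hZ
  have : IsProbabilityMeasure (P.map fun ω i => Z i ω) :=
    Measure.isProbabilityMeasure_map hz.aemeasurable
  have hmap := (indepFun_iff_map_prod_eq_prod_map_map hp.aemeasurable hq.aemeasurable).1
    (indepFun_past_future hZ hI k)
  rw [map_future hZ hI hid k] at hmap
  rw [← lintegral_map hf (hp.prodMk hq), hmap, lintegral_prod _ hf.aemeasurable,
    lintegral_map hf.lintegral_prod_right' hp]
  refine lintegral_congr fun ω => ?_
  exact lintegral_map (hf.comp measurable_prodMk_left) hz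

end RandomWalk

/-! ### The ladder height law, its renewal equation and its defect -/

section LadderLaw

variable {Ω : Type*} [MeasurableSpace Ω] {P : Measure Ω} {Z : ℕ → Ω → ℝ}

/-- The law of the first positive partial sum, on the event that there is one. -/
def heightLaw (P : Measure Ω) (Z : ℕ → Ω → ℝ) : Measure ℝ :=
  Measure.sum fun k => (P.restrict (firstPassage Z k)).map (partialSum Z k)

lemma lintegral_heightLaw (hZ : ∀ i, Measurable (Z i)) {f : ℝ → ℝ≥0∞} (hf : Measurable f) :
    ∫⁻ x, f x ∂heightLaw P Z = ∑' k, ∫⁻ ω in firstPassage Z k, f (partialSum Z k ω) ∂P := by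
  rw [heightLaw, lintegral_sum_measure]
  exact tsum_congr fun k => lintegral_map hf (measurable_partialSum hZ k)

lemma heightLaw_apply (hZ : ∀ i, Measurable (Z i)) {B : Set ℝ} (hB : MeasurableSet B) :
    heightLaw P Z B = ∑' k, P (partialSum Z k ⁻¹' B ∩ firstPassage Z k) := by
  rw [heightLaw, Measure.sum_apply _ hB]
  refine tsum_congr fun k => ?_
  rw [Measure.map_apply (measurable_partialSum hZ k) hB,
    Measure.restrict_apply (measurable_partialSum hZ k hB)]

lemma heightLaw_Iic_zero (hZ : ∀ i, Measurable (Z i)) : heightLaw P Z (Set.Iic 0) = 0 := by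
  rw [heightLaw_apply hZ measurableSet_Iic, ENNReal.tsum_eq_zero]
  intro k
  have : partialSum Z k ⁻¹' Set.Iic 0 ∩ firstPassage Z k = ∅ :=
    Set.eq_empty_of_forall_notMem fun ω h => (show partialSum Z k ω ≤ 0 from h.1).not_gt h.2.2
  rw [this, measure_empty]

lemma heightLaw_univ (hZ : ∀ i, Measurable (Z i)) :
    heightLaw P Z Set.univ = P (exceeds Z 0) := by
  rw [heightLaw_apply hZ MeasurableSet.univ]
  simp only [Set.preimage_univ, Set.univ_inter]
  rw [← measure_iUnion (pairwise_disjoint_firstPassage Z) (measurableSet_firstPassage hZ)]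
  congr 1
  ext ω
  rw [Set.mem_iUnion]
  constructor
  · rintro ⟨k, hk⟩
    exact ⟨k, hk.2⟩
  · rintro ⟨n, hn⟩
    obtain ⟨k, -, hk⟩ := exists_mem_firstPassage hn
    exact ⟨k, hk⟩

lemma isFiniteMeasure_heightLaw [IsFiniteMeasure P] (hZ : ∀ i, Measurable (Z i)) :
    IsFiniteMeasure (heightLaw P Z) :=
  ⟨by rw [heightLaw_univ hZ]; exact measure_lt_top _ _⟩

lemma measurable_measure_exceeds (P : Measure Ω) (Z : ℕ → Ω → ℝ) :
    Measurable fun u => P (exceeds Z u) :=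
  Antitone.measurable fun _ _ h => measure_mono (exceeds_antitone Z h)

/-- The renewal equation for the probability that the partial sums exceed a level. -/
theorem measure_exceeds_eq_lintegral [IsProbabilityMeasure P] (hZ : ∀ i, Measurable (Z i))
    (hI : iIndepFun Z P) (hid : ∀ i, IdentDistrib (Z i) (Z 0) P P) {u : ℝ} (hu : 0 ≤ u) :
    P (exceeds Z u) = ∫⁻ x, P (exceeds Z (u - x)) ∂heightLaw P Z := by
  have hmeas : Measurable fun x => P (exceeds Z (u - x)) :=
    (measurable_measure_exceeds P Z).comp (measurable_const.sub measurable_id)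
  rw [lintegral_heightLaw hZ hmeas]
  -- The event is written as a condition on the pair (past, future), so that integrating its
  -- indicator replaces the future by an independent copy of the walk.
  have hset (k : ℕ) : MeasurableSet {q : (ℕ → ℝ) × (ℕ → ℝ) |
      q.1 ∈ firstPassage coord k ∧ q.2 ∈ exceeds coord (u - partialSum coord k q.1)} := by
    have h : {q : (ℕ → ℝ) × (ℕ → ℝ) |
        q.1 ∈ firstPassage coord k ∧ q.2 ∈ exceeds coord (u - partialSum coord k q.1)} =
        Prod.fst ⁻¹' firstPassage coord k ∩ ⋃ n, {q : (ℕ → ℝ) × (ℕ → ℝ) |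
          u - partialSum coord k q.1 < partialSum coord n q.2} := by
      ext q; simp [exceeds]
    rw [h]
    refine (measurable_fst (measurableSet_firstPassage measurable_coord k)).inter
      (MeasurableSet.iUnion fun n => measurableSet_lt ?_ ?_)
    · exact measurable_const.sub ((measurable_partialSum measurable_coord k).comp measurable_fst)
    · exact (measurable_partialSum measurable_coord n).comp measurable_snd
  have hpre (k : ℕ) : firstPassage Z k ∩
      {ω | future Z k ω ∈ exceeds coord (u - partialSum Z k ω)} =
      (fun ω => (past Z k ω, future Z k ω)) ⁻¹' {q : (ℕ → ℝ) × (ℕ → ℝ) |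
        q.1 ∈ firstPassage coord k ∧ q.2 ∈ exceeds coord (u - partialSum coord k q.1)} := by
    ext ω
    simp only [Set.mem_inter_iff, Set.mem_ofPred_eq, Set.mem_preimage, past_mem_firstPassage,
      partialSum_coord_past Z le_rfl]
  have hpair (k : ℕ) := (measurable_past hZ k).prodMk (measurable_future hZ k)
  rw [exceeds_eq_iUnion Z hu, measure_iUnion]
  · refine tsum_congr fun k => ?_
    rw [hpre k, ← lintegral_indicator_one (hpair k (hset k)),
      ← lintegral_indicator (measurableSet_firstPassage hZ k)]
    have hind := (measurable_one (α := ℝ≥0∞)).indicator (hset k)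
    have h := lintegral_past_future hZ hI hid k hind
    refine Eq.trans (lintegral_congr fun ω => ?_) (h.trans (lintegral_congr fun ω => ?_))
    · rfl
    · by_cases hω : ω ∈ firstPassage Z k
      · rw [Set.indicator_of_mem hω]
        rw [← lintegral_indicator_one (measurableSet_exceeds hZ _)]
        refine lintegral_congr fun ω' => ?_
        have hiff : (past Z k ω, fun i => Z i ω') ∈ {q : (ℕ → ℝ) × (ℕ → ℝ) |
            q.1 ∈ firstPassage coord k ∧ q.2 ∈ exceeds coord (u - partialSum coord k q.1)} ↔
            ω' ∈ exceeds Z (u - partialSum Z k ω) := by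
          simp only [Set.mem_ofPred_eq, past_mem_firstPassage, partialSum_coord_past Z le_rfl, hω,
            true_and]
          rfl
        by_cases h' : ω' ∈ exceeds Z (u - partialSum Z k ω)
        · rw [Set.indicator_of_mem h', Set.indicator_of_mem (hiff.2 h')]; rfl
        · rw [Set.indicator_of_notMem h', Set.indicator_of_notMem (mt hiff.1 h')]
      · rw [Set.indicator_of_notMem hω]
        refine (lintegral_congr fun ω' => Set.indicator_of_notMem ?_ _).trans lintegral_zero
        exact fun h' => hω (past_mem_firstPassage.1 h'.1)
  · exact fun i j hij => (pairwise_disjoint_firstPassage Z hij).mono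
      Set.inter_subset_left Set.inter_subset_left
  · intro k
    rw [hpre k]
    exact hpair k (hset k)

/-- A set all of whose translates are null for the increment is null for the ladder height. -/
lemma heightLaw_eq_zero_of_forall_translate [IsProbabilityMeasure P] (hZ : ∀ i, Measurable (Z i))
    (hI : iIndepFun Z P) (hid : ∀ i, IdentDistrib (Z i) (Z 0) P P) {N : Set ℝ}
    (hN : MeasurableSet N) (h : ∀ y, P {ω | y + Z 0 ω ∈ N} = 0) : heightLaw P Z N = 0 := by
  rw [heightLaw_apply hZ hN, ENNReal.tsum_eq_zero]
  intro k
  rcases k with _ | k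
  · simp [firstPassage_zero]
  -- The first-passage condition can be dropped: given the past, `S_{k+1} = S_k + Z_k` already
  -- avoids `N` almost surely.
  refine measure_mono_null Set.inter_subset_left ?_
  have hset : MeasurableSet {q : (ℕ → ℝ) × (ℕ → ℝ) | partialSum coord k q.1 + coord 0 q.2 ∈ N} :=
    (((measurable_partialSum measurable_coord k).comp measurable_fst).add
      ((measurable_coord 0).comp measurable_snd)) hN
  have hpair := (measurable_past hZ k).prodMk (measurable_future hZ k)
  have hpre : partialSum Z (k + 1) ⁻¹' N = (fun ω => (past Z k ω, future Z k ω)) ⁻¹'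
      {q : (ℕ → ℝ) × (ℕ → ℝ) | partialSum coord k q.1 + coord 0 q.2 ∈ N} := by
    ext ω
    simp only [Set.mem_ofPred_eq, Set.mem_preimage, partialSum_coord_past Z le_rfl,
      partialSum_succ]
    rfl
  rw [hpre, ← lintegral_indicator_one (hpair hset)]
  have hind := (measurable_one (α := ℝ≥0∞)).indicator hset
  have h1 := lintegral_past_future hZ hI hid k hind
  refine Eq.trans (Eq.trans (lintegral_congr fun ω => rfl) h1) ?_
  refine (lintegral_congr fun ω => ?_).trans lintegral_zero
  have hms : MeasurableSet {ω' | partialSum Z k ω + Z 0 ω' ∈ N} :=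
    (measurable_const.add (hZ 0)) hN
  refine Eq.trans (lintegral_congr fun ω' => ?_)
    ((lintegral_indicator_one hms).trans (h (partialSum Z k ω)))
  by_cases h' : ω' ∈ {ω' | partialSum Z k ω + Z 0 ω' ∈ N}
  · rw [Set.indicator_of_mem h', Set.indicator_of_mem]
    · rfl
    · simpa only [Set.mem_ofPred_eq, partialSum_coord_past Z le_rfl, coord] using h'
  · rw [Set.indicator_of_notMem h', Set.indicator_of_notMem]
    simpa only [Set.mem_ofPred_eq, partialSum_coord_past Z le_rfl, coord] using h'

/-- A subinvariant function for a positive convolution kernel that grows at most exponentially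
vanishes. -/
lemma eq_zero_of_le_lintegral_sub {G : Measure ℝ} {v : ℝ → ℝ≥0∞} {c : ℝ}
    (hv : ∀ u, v u ≤ ENNReal.ofReal (Real.exp (c * u)))
    (hsub : ∀ u, v u ≤ ∫⁻ x, v (u - x) ∂G)
    (hG : ∫⁻ x, ENNReal.ofReal (Real.exp (-c * x)) ∂G < 1) (u : ℝ) : v u = 0 := by
  set ρ := ∫⁻ x, ENNReal.ofReal (Real.exp (-c * x)) ∂G with hρ
  -- Each use of the inequality `hsub` gains a factor `ρ < 1`.
  have key (n : ℕ) : ∀ u, v u ≤ ρ ^ n * ENNReal.ofReal (Real.exp (c * u)) := by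
    induction n with
    | zero => simpa using hv
    | succ n ih =>
      intro u
      calc v u ≤ ∫⁻ x, v (u - x) ∂G := hsub u
        _ ≤ ∫⁻ x, (ρ ^ n * ENNReal.ofReal (Real.exp (c * u))) *
              ENNReal.ofReal (Real.exp (-c * x)) ∂G := by
            refine lintegral_mono fun x => (ih (u - x)).trans (le_of_eq ?_)
            rw [mul_assoc, ← ENNReal.ofReal_mul (Real.exp_pos _).le, ← Real.exp_add]
            ring_nf
        _ = ρ ^ (n + 1) * ENNReal.ofReal (Real.exp (c * u)) := by
            rw [lintegral_const_mul _ (by fun_prop), ← hρ]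
            ring
  have hlim : Tendsto (fun n => ρ ^ n * ENNReal.ofReal (Real.exp (c * u))) atTop (𝓝 0) := by
    have := ENNReal.Tendsto.mul_const (b := ENNReal.ofReal (Real.exp (c * u)))
      (ENNReal.tendsto_pow_atTop_nhds_zero_of_lt_one hG) (Or.inr ENNReal.ofReal_ne_top)
    simpa using this
  exact le_antisymm (ge_of_tendsto' hlim fun n => key n u) zero_le

/-- The Laplace transform of a probability measure on the positive half-line is less than one. -/
lemma lintegral_exp_neg_lt_one {G : Measure ℝ} [IsProbabilityMeasure G]
    (h0 : G (Set.Iic 0) = 0) {c : ℝ} (hc : 0 < c) :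
    ∫⁻ x, ENNReal.ofReal (Real.exp (-c * x)) ∂G < 1 := by
  have hae : ∀ᵐ x ∂G, 0 < x := by
    rw [ae_iff]; simp only [not_lt]; exact h0
  have hlt : ∀ᵐ x ∂G, ENNReal.ofReal (Real.exp (-c * x)) < 1 := by
    filter_upwards [hae] with x hx
    rw [ENNReal.ofReal_lt_one, Real.exp_lt_one_iff]
    nlinarith
  have h := lintegral_strict_mono (μ := G) (f := fun x => ENNReal.ofReal (Real.exp (-c * x)))
    (g := fun _ => 1) (IsProbabilityMeasure.ne_zero G) (by fun_prop) ?_ hlt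
  · simpa using h
  · have : ∫⁻ x, ENNReal.ofReal (Real.exp (-c * x)) ∂G ≤ ∫⁻ _, 1 ∂G :=
      lintegral_mono_ae (hlt.mono fun _ h => h.le)
    exact (this.trans_lt (by simp)).ne

/-- A random walk drifting to `-∞` has a defective ladder height. -/
theorem heightLaw_univ_lt_one [IsProbabilityMeasure P] (hZ : ∀ i, Measurable (Z i))
    (hI : iIndepFun Z P) (hid : ∀ i, IdentDistrib (Z i) (Z 0) P P)
    (hdrift : ∀ᵐ ω ∂P, Tendsto (fun n => partialSum Z n ω) atTop atBot) :
    heightLaw P Z Set.univ < 1 := by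
  have hle : heightLaw P Z Set.univ ≤ 1 := by
    rw [heightLaw_univ hZ]; exact prob_le_one
  refine lt_of_le_of_ne hle fun h1 => ?_
  have hprob : IsProbabilityMeasure (heightLaw P Z) := ⟨h1⟩
  have hle1 (u : ℝ) : P (exceeds Z u) ≤ 1 := prob_le_one
  -- If the ladder law had mass one, `1 - P(sup S_n > u)` would be subinvariant on the whole line,
  -- being zero for `u < 0`, and hence vanish. Every level would then be exceeded almost surely,
  -- although a path tending to `-∞` is bounded above.
  have hv := eq_zero_of_le_lintegral_sub (G := heightLaw P Z) (c := 1)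
    (v := fun u => 1 - P (exceeds Z u)) ?_ ?_ (lintegral_exp_neg_lt_one
      (heightLaw_Iic_zero hZ) one_pos)
  · have hall : ∀ᵐ ω ∂P, ∀ m : ℕ, ω ∈ exceeds Z m := by
      rw [ae_all_iff]
      intro m
      have : P (exceeds Z m) = 1 := le_antisymm (hle1 _) (tsub_eq_zero_iff_le.1 (hv m))
      exact (prob_compl_eq_zero_iff (measurableSet_exceeds hZ _)).2 this
    obtain ⟨ω, h1, h2⟩ := (hall.and hdrift).exists
    obtain ⟨b, hb⟩ := h2.isBoundedUnder_le_atBot.bddAbove_range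
    obtain ⟨m, hm⟩ := exists_nat_ge b
    obtain ⟨n, hn⟩ := h1 m
    exact absurd (hb ⟨n, rfl⟩) (not_le.2 (hm.trans_lt hn))
  · intro u
    rcases lt_or_ge u 0 with hu | hu
    · simp [exceeds_of_neg Z hu]
    · refine tsub_le_self.trans ?_
      rw [ENNReal.one_le_ofReal]
      exact Real.one_le_exp (by simpa using hu)
  · intro u
    rcases lt_or_ge u 0 with hu | hu
    · simp [exceeds_of_neg Z hu]
    · have hm : Measurable fun x => P (exceeds Z (u - x)) :=
        (measurable_measure_exceeds P Z).comp (measurable_const.sub measurable_id)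
      rw [lintegral_sub hm, lintegral_one, h1, ← measure_exceeds_eq_lintegral hZ hI hid hu]
      · exact ((lintegral_mono fun x => hle1 (u - x)).trans_lt (by simp)).ne
      · exact Eventually.of_forall fun x => hle1 _

end LadderLaw

/-! ### Wiener-Hopf comparison of exponential moments and the sign of adjustment coefficients -/

section ExponentialMoments

/-- The value `1` rules out both an infinite moment and the default value `0` of the Bochner
integral, so integrability need not be carried along. -/
lemma isAdjustmentCoefficient_iff_lintegral {ν : Measure ℝ} {r : ℝ} :
    IsAdjustmentCoefficient ν r ↔ r ≠ 0 ∧ ∫⁻ x, ENNReal.ofReal (Real.exp (r * x)) ∂ν = 1 := by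
  rw [IsAdjustmentCoefficient, integral_eq_lintegral_of_nonneg_ae
    (Eventually.of_forall fun x => (Real.exp_pos _).le) (by fun_prop), ENNReal.toReal_eq_one_iff]

variable {Ω : Type*} [MeasurableSpace Ω] {P : Measure Ω} {Z : ℕ → Ω → ℝ}

/-- One step of the exponential moment of a random walk killed at its first positive value. -/
lemma lintegral_exp_noPassage_step [IsProbabilityMeasure P] (hZ : ∀ i, Measurable (Z i))
    (hI : iIndepFun Z P) (hid : ∀ i, IdentDistrib (Z i) (Z 0) P P) (r : ℝ) (n : ℕ) :
    (∫⁻ ω, ENNReal.ofReal (Real.exp (r * Z 0 ω)) ∂P) *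
        ∫⁻ ω in noPassage Z n, ENNReal.ofReal (Real.exp (r * partialSum Z n ω)) ∂P =
      (∫⁻ ω in noPassage Z (n + 1), ENNReal.ofReal (Real.exp (r * partialSum Z (n + 1) ω)) ∂P) +
        ∫⁻ ω in firstPassage Z (n + 1),
          ENNReal.ofReal (Real.exp (r * partialSum Z (n + 1) ω)) ∂P := by
  rw [← lintegral_union (measurableSet_firstPassage hZ _) (disjoint_noPassage_firstPassage Z _),
    ← noPassage_eq_union, ← lintegral_indicator (measurableSet_noPassage hZ n),
    ← lintegral_indicator (measurableSet_noPassage hZ n)]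
  have hS := measurable_partialSum measurable_coord n
  have h0 := measurable_coord 0
  let f : (ℕ → ℝ) × (ℕ → ℝ) → ℝ≥0∞ := fun q =>
    (noPassage coord n).indicator
      (fun v => ENNReal.ofReal (Real.exp (r * partialSum coord n v))) q.1 *
      ENNReal.ofReal (Real.exp (r * coord 0 q.2))
  have hf : Measurable f := by
    refine Measurable.mul (Measurable.comp (Measurable.indicator ?_
      (measurableSet_noPassage measurable_coord n)) measurable_fst) ?_ <;> fun_prop
  have hpast (ω : Ω) : (noPassage coord n).indicator
      (fun v => ENNReal.ofReal (Real.exp (r * partialSum coord n v))) (past Z n ω) =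
      (noPassage Z n).indicator
        (fun ω => ENNReal.ofReal (Real.exp (r * partialSum Z n ω))) ω := by
    by_cases h : ω ∈ noPassage Z n
    · rw [Set.indicator_of_mem h, Set.indicator_of_mem (past_mem_noPassage.2 h),
        partialSum_coord_past Z le_rfl]
    · rw [Set.indicator_of_notMem h, Set.indicator_of_notMem (mt past_mem_noPassage.1 h)]
  have h := lintegral_past_future hZ hI hid n hf
  refine Eq.trans ?_ (h.symm.trans ?_)
  · have hm : Measurable ((noPassage Z n).indicator
        (fun ω => ENNReal.ofReal (Real.exp (r * partialSum Z n ω)))) := by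
      have := measurable_partialSum hZ n
      exact Measurable.indicator (by fun_prop) (measurableSet_noPassage hZ n)
    rw [← lintegral_const_mul _ hm]
    refine lintegral_congr fun ω => ?_
    simp only [f, hpast]
    have := hZ 0
    rw [lintegral_const_mul _ (by unfold coord; fun_prop), mul_comm]
    rfl
  · refine lintegral_congr fun ω => ?_
    simp only [f, hpast]
    by_cases h : ω ∈ noPassage Z n
    · rw [Set.indicator_of_mem h, Set.indicator_of_mem h,
        ← ENNReal.ofReal_mul (Real.exp_pos _).le, ← Real.exp_add, partialSum_succ, mul_add]
      rfl
    · rw [Set.indicator_of_notMem h, Set.indicator_of_notMem h, zero_mul]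

/-- Before its first positive value, a random walk drifting to `-∞` loses its exponential mass. -/
lemma tendsto_lintegral_exp_noPassage [IsProbabilityMeasure P] (hZ : ∀ i, Measurable (Z i))
    (hdrift : ∀ᵐ ω ∂P, Tendsto (fun n => partialSum Z n ω) atTop atBot) {r : ℝ} (hr : 0 < r) :
    Tendsto (fun n => ∫⁻ ω in noPassage Z n,
      ENNReal.ofReal (Real.exp (r * partialSum Z n ω)) ∂P) atTop (𝓝 0) := by
  simp_rw [← lintegral_indicator (measurableSet_noPassage hZ _)]
  have hm (n : ℕ) : Measurable ((noPassage Z n).indicator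
      (fun ω => ENNReal.ofReal (Real.exp (r * partialSum Z n ω)))) := by
    have := measurable_partialSum hZ n
    exact Measurable.indicator (by fun_prop) (measurableSet_noPassage hZ n)
  have h := tendsto_lintegral_of_dominated_convergence (μ := P)
    (F := fun n => (noPassage Z n).indicator
      (fun ω => ENNReal.ofReal (Real.exp (r * partialSum Z n ω))))
    (f := fun _ => 0) (fun _ => 1) hm ?_ (by simp) ?_
  · simpa using h
  · refine fun n => Eventually.of_forall fun ω => ?_
    refine Set.indicator_apply_le' (fun hω => ?_) fun _ => zero_le_one
    rw [ENNReal.ofReal_le_one, Real.exp_le_one_iff]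
    exact mul_nonpos_of_nonneg_of_nonpos hr.le (hω n le_rfl)
  · filter_upwards [hdrift] with ω hω
    have h1 : Tendsto (fun n => ENNReal.ofReal (Real.exp (r * partialSum Z n ω))) atTop (𝓝 0) := by
      have h2 := Real.tendsto_exp_atBot.comp (hω.const_mul_atBot hr)
      simpa using ENNReal.tendsto_ofReal h2
    refine tendsto_of_tendsto_of_tendsto_of_le_of_le tendsto_const_nhds h1
      (fun _ => zero_le) fun n => ?_
    exact Set.indicator_apply_le' (fun _ => le_rfl) fun _ => zero_le

/-- Wiener-Hopf: the ladder height and the increment of a random walk drifting to `-∞` have the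
same positive solutions `r` of `E e^{r ·} = 1`. -/
theorem lintegral_exp_heightLaw_eq_one_iff [IsProbabilityMeasure P] (hZ : ∀ i, Measurable (Z i))
    (hI : iIndepFun Z P) (hid : ∀ i, IdentDistrib (Z i) (Z 0) P P)
    (hdrift : ∀ᵐ ω ∂P, Tendsto (fun n => partialSum Z n ω) atTop atBot) {r : ℝ} (hr : 0 < r) :
    ∫⁻ x, ENNReal.ofReal (Real.exp (r * x)) ∂heightLaw P Z = 1 ↔
      ∫⁻ ω, ENNReal.ofReal (Real.exp (r * Z 0 ω)) ∂P = 1 := by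
  set m := ∫⁻ ω, ENNReal.ofReal (Real.exp (r * Z 0 ω)) ∂P
  set a : ℕ → ℝ≥0∞ := fun n =>
    ∫⁻ ω in noPassage Z n, ENNReal.ofReal (Real.exp (r * partialSum Z n ω)) ∂P with ha
  set b : ℕ → ℝ≥0∞ := fun n =>
    ∫⁻ ω in firstPassage Z n, ENNReal.ofReal (Real.exp (r * partialSum Z n ω)) ∂P with hb
  have hF : ∫⁻ x, ENNReal.ofReal (Real.exp (r * x)) ∂heightLaw P Z = ∑' k, b k :=
    lintegral_heightLaw hZ (by fun_prop)
  have hstep (n : ℕ) : m * a n = a (n + 1) + b (n + 1) :=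
    lintegral_exp_noPassage_step hZ hI hid r n
  have ha0 : a 0 = 1 := by simp [ha, noPassage_zero, partialSum_zero]
  have hb0 : b 0 = 0 := by simp [hb, firstPassage_zero]
  have hlim : Tendsto a atTop (𝓝 0) := tendsto_lintegral_exp_noPassage hZ hdrift hr
  have hale (n : ℕ) : a n ≤ 1 := by
    calc a n ≤ ∫⁻ _ in noPassage Z n, 1 ∂P := by
          refine setLIntegral_mono measurable_const fun ω hω => ?_
          rw [ENNReal.ofReal_le_one, Real.exp_le_one_iff]
          exact mul_nonpos_of_nonneg_of_nonpos hr.le (hω n le_rfl)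
      _ ≤ 1 := by simpa using prob_le_one
  -- Sum of the one-step identities, with `a 0 = 1` and `b 0 = 0`. It says `(m - 1) ∑ a = a N + ∑ b
  -- - 1`, in a form free of subtraction in `ℝ≥0∞`.
  have hid' (N : ℕ) : m * (∑ n ∈ Finset.range N, a n) + 1 =
      (∑ n ∈ Finset.range N, a n) + (a N + ∑ n ∈ Finset.range (N + 1), b n) := by
    induction N with
    | zero => simp [ha0, hb0]
    | succ N ih =>
      rw [Finset.sum_range_succ a, mul_add, hstep, add_right_comm, ih,
        Finset.sum_range_succ b (N + 1)]
      ring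
  have hAtop (N : ℕ) : ∑ n ∈ Finset.range N, a n ≠ ∞ :=
    ENNReal.sum_ne_top.2 fun n _ => ((hale n).trans_lt ENNReal.one_lt_top).ne
  have htend : Tendsto (fun N => a N + ∑ n ∈ Finset.range (N + 1), b n) atTop
      (𝓝 (∑' k, b k)) := by
    have h1 := (ENNReal.tendsto_nat_tsum b).comp (tendsto_add_atTop_nat 1)
    simpa using hlim.add h1
  rw [hF]
  constructor
  · intro hone
    rw [hone] at htend
    have hm : m ≠ ∞ := by
      have h := hstep 0
      rw [ha0, mul_one] at h
      rw [h]
      refine ENNReal.add_ne_top.2 ⟨((hale _).trans_lt ENNReal.one_lt_top).ne, ?_⟩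
      exact ((ENNReal.le_tsum 1).trans_lt (hone ▸ ENNReal.one_lt_top)).ne
    have hctop (N : ℕ) : a N + ∑ n ∈ Finset.range (N + 1), b n ≠ ∞ := by
      refine ENNReal.add_ne_top.2 ⟨((hale _).trans_lt ENNReal.one_lt_top).ne, ?_⟩
      exact ((ENNReal.sum_le_tsum _).trans_lt (hone ▸ ENNReal.one_lt_top)).ne
    have hreal := (ENNReal.tendsto_toReal ENNReal.one_ne_top).comp htend
    have hdiff : Tendsto (fun N => |(a N + ∑ n ∈ Finset.range (N + 1), b n).toReal - 1|) atTop
        (𝓝 0) := by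
      simpa using (hreal.sub_const 1).abs
    have hdiff' := hdiff.comp (tendsto_add_atTop_nat 1)
    -- The index `N + 1` ensures that the sum of the `a n` contains `a 0 = 1`. Thus `|m - 1|` is at
    -- most a quantity tending to `0`.
    have hbound (N : ℕ) : |m.toReal - 1| ≤
        |(a (N + 1) + ∑ n ∈ Finset.range (N + 1 + 1), b n).toReal - 1| := by
      have h := congrArg ENNReal.toReal (hid' (N + 1))
      rw [ENNReal.toReal_add (ENNReal.mul_ne_top hm (hAtop _)) ENNReal.one_ne_top,
        ENNReal.toReal_mul, ENNReal.toReal_add (hAtop _) (hctop _), ENNReal.toReal_one] at h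
      have hA : 1 ≤ (∑ n ∈ Finset.range (N + 1), a n).toReal := by
        have : (1 : ℝ≥0∞) ≤ ∑ n ∈ Finset.range (N + 1), a n := by
          rw [← ha0]
          exact Finset.single_le_sum (f := a) (fun _ _ => zero_le) (by simp)
        simpa using (ENNReal.toReal_le_toReal ENNReal.one_ne_top (hAtop _)).2 this
      have h2 : (a (N + 1) + ∑ n ∈ Finset.range (N + 1 + 1), b n).toReal - 1 =
          (m.toReal - 1) * (∑ n ∈ Finset.range (N + 1), a n).toReal := by linarith
      rw [h2, abs_mul, abs_of_nonneg (zero_le_one.trans hA)]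
      exact le_mul_of_one_le_right (abs_nonneg _) hA
    have h0 : |m.toReal - 1| ≤ 0 := ge_of_tendsto' hdiff' hbound
    rw [← ENNReal.toReal_eq_one_iff]
    linarith [abs_nonpos_iff.1 h0]
  · intro hm
    refine tendsto_nhds_unique htend (tendsto_const_nhds.congr fun N => ?_)
    have h := hid' N
    rw [hm, one_mul] at h
    exact (ENNReal.add_right_inj (hAtop N)).1 h

/-- A law on the positive half-line of mass less than one has only positive adjustment
coefficients. -/
lemma IsAdjustmentCoefficient.pos_of_defective {ν : Measure ℝ} (h0 : ν (Set.Iic 0) = 0)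
    (h1 : ν Set.univ < 1) {r : ℝ} (hr : IsAdjustmentCoefficient ν r) : 0 < r := by
  obtain ⟨hne, h⟩ := isAdjustmentCoefficient_iff_lintegral.1 hr
  by_contra hneg
  have hae : ∀ᵐ x ∂ν, 0 < x := by
    rw [ae_iff]; simp only [not_lt]; exact h0
  have hle : ∫⁻ x, ENNReal.ofReal (Real.exp (r * x)) ∂ν ≤ ∫⁻ _, 1 ∂ν := by
    refine lintegral_mono_ae (hae.mono fun x hx => ?_)
    rw [ENNReal.ofReal_le_one, Real.exp_le_one_iff]
    exact mul_nonpos_of_nonpos_of_nonneg (not_lt.1 hneg) hx.le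
  rw [h, lintegral_one] at hle
  exact hle.not_gt h1

/-- A law of negative mean has only positive adjustment coefficients. -/
lemma IsAdjustmentCoefficient.pos_of_integral_neg {ν : Measure ℝ} [IsProbabilityMeasure ν]
    (hint : Integrable (fun x => x) ν) (hmean : ∫ x, x ∂ν < 0) {r : ℝ}
    (hr : IsAdjustmentCoefficient ν r) : 0 < r := by
  obtain ⟨hne, h⟩ := hr
  by_contra hneg
  have hneg' : r < 0 := lt_of_le_of_ne (not_lt.1 hneg) hne
  have hexp : Integrable (fun x => Real.exp (r * x)) ν := by
    by_contra hni
    rw [integral_undef hni] at h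
    exact zero_ne_one h
  -- Integrating `e^{rx} ≥ 1 + rx` gives `r` times the mean at most `0`, impossible when both are
  -- negative.
  have hle : ∫ x, (r * x + 1) ∂ν ≤ ∫ x, Real.exp (r * x) ∂ν :=
    integral_mono ((hint.const_mul r).add (integrable_const 1)) hexp
      fun x => Real.add_one_le_exp (r * x)
  rw [integral_add (hint.const_mul r) (integrable_const 1), integral_const_mul, h] at hle
  simp only [integral_const, probReal_univ, smul_eq_mul, mul_one] at hle
  nlinarith

end ExponentialMoments

/-! ### A one-sided key renewal theorem for atomless laws -/

section Renewal

/-- Bounded functions with pointwise upper limit at most `b` have vanishing mean excess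
over `b`. -/
lemma tendsto_integral_posPart_mul {α : Type*} [MeasurableSpace α] {ν : Measure α}
    {f : ℕ → α → ℝ} {w : α → ℝ} {b M : ℝ} (hf : ∀ n, Measurable (f n)) (hM : ∀ n x, |f n x| ≤ M)
    (hw : Integrable w ν) (hlim : ∀ x, ∀ ε > 0, ∀ᶠ n in atTop, f n x ≤ b + ε) :
    Tendsto (fun n => ∫ x, max (f n x - b) 0 * w x ∂ν) atTop (𝓝 0) := by
  have h := tendsto_integral_of_dominated_convergence (μ := ν) (f := fun _ => (0 : ℝ))
    (F := fun n x => max (f n x - b) 0 * w x) (fun x => (M + |b|) * ‖w x‖) ?_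
    (hw.norm.const_mul _) ?_ ?_
  · simpa using h
  · intro n
    have := hf n
    exact (by fun_prop : Measurable fun x => max (f n x - b) 0).aestronglyMeasurable.mul
      hw.aestronglyMeasurable
  · refine fun n => Eventually.of_forall fun x => ?_
    rw [norm_mul]
    refine mul_le_mul_of_nonneg_right ?_ (norm_nonneg _)
    rw [Real.norm_of_nonneg (le_max_right _ _)]
    have h1 := hM n x
    have h2 := abs_le.1 h1
    refine max_le ?_ (add_nonneg ((abs_nonneg _).trans h1) (abs_nonneg _))
    linarith [neg_abs_le b]
  · refine Eventually.of_forall fun x => ?_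
    have h0 : Tendsto (fun n => max (f n x - b) 0) atTop (𝓝 0) := by
      rw [Metric.tendsto_atTop']
      intro ε hε
      obtain ⟨N, hN⟩ := eventually_atTop.1 (hlim x (ε / 2) (half_pos hε))
      refine ⟨N, fun n hn => ?_⟩
      rw [Real.dist_eq, sub_zero, abs_of_nonneg (le_max_right _ _)]
      exact max_lt (by linarith [hN n hn.le]) hε
    simpa using h0.mul_const (w x)

lemma integrable_of_forall_abs_le {α : Type*} [MeasurableSpace α] {ν : Measure α}
    [IsFiniteMeasure ν] {f : α → ℝ} {M : ℝ} (hf : Measurable f) (hM : ∀ x, |f x| ≤ M) :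
    Integrable f ν :=
  (integrable_const M).mono' hf.aestronglyMeasurable (Eventually.of_forall hM)

/-- Bounded functions whose means converge to a bound of their pointwise upper limits converge
in mean. -/
lemma tendsto_integral_abs_sub_of_limsup_le {α : Type*} [MeasurableSpace α] {G : Measure α}
    [IsProbabilityMeasure G] {f : ℕ → α → ℝ} {b M : ℝ} (hf : ∀ n, Measurable (f n))
    (hM : ∀ n x, |f n x| ≤ M) (hlim : ∀ x, ∀ ε > 0, ∀ᶠ n in atTop, f n x ≤ b + ε)
    (hint : Tendsto (fun n => ∫ x, f n x ∂G) atTop (𝓝 b)) :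
    Tendsto (fun n => ∫ x, |f n x - b| ∂G) atTop (𝓝 0) := by
  have h1 := tendsto_integral_posPart_mul hf hM (integrable_const (μ := G) (1 : ℝ)) hlim
  simp only [mul_one] at h1
  -- Uses `|t| = 2 max t 0 - t`: the mean positive part vanishes by dominated convergence and the
  -- mean of `f n - b` by hypothesis.
  have h2 := (h1.const_mul 2).sub (hint.sub_const b)
  rw [mul_zero, sub_self, sub_self] at h2
  refine h2.congr fun n => ?_
  have hi : Integrable (f n) G := integrable_of_forall_abs_le (hf n) (hM n)
  have hi' : Integrable (fun x => f n x - b) G := hi.sub (integrable_const b)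
  have hp : Integrable (fun x => max (f n x - b) 0) G := hi'.pos_part
  have e1 : ∫ x, f n x ∂G - b = ∫ x, (f n x - b) ∂G := by
    rw [integral_sub hi (integrable_const b)]; simp
  rw [e1, ← integral_const_mul, ← integral_sub (hp.const_mul 2) hi']
  refine integral_congr_ae (Eventually.of_forall fun x => ?_)
  rcases le_total (f n x - b) 0 with h | h
  · simp [max_eq_right h, abs_of_nonpos h]
  · simp only [max_eq_left h, abs_of_nonneg h]; ring

/-- A reverse Fatou inequality against an integrable weight. -/
lemma le_mul_integral_of_limsup_le {α : Type*} [MeasurableSpace α] {ν : Measure α}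
    {f : ℕ → α → ℝ} {w : α → ℝ} {b C M : ℝ} (hf : ∀ n, Measurable (f n))
    (hM : ∀ n x, |f n x| ≤ M) (hw : Integrable w ν) (hw0 : ∀ x, 0 ≤ w x)
    (hlim : ∀ x, ∀ ε > 0, ∀ᶠ n in atTop, f n x ≤ b + ε)
    (hint : Tendsto (fun n => ∫ x, f n x * w x ∂ν) atTop (𝓝 C)) : C ≤ b * ∫ x, w x ∂ν := by
  have h1 := (tendsto_integral_posPart_mul hf hM hw hlim).const_add (b * ∫ x, w x ∂ν)
  rw [add_zero] at h1
  refine le_of_tendsto_of_tendsto' hint h1 fun n => ?_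
  have hfw : Integrable (fun x => f n x * w x) ν :=
    hw.bdd_mul (hf n).aestronglyMeasurable (Eventually.of_forall (hM n))
  have hpw : Integrable (fun x => max (f n x - b) 0 * w x) ν := by
    have := hf n
    refine hw.bdd_mul (c := M + |b|)
      (by fun_prop : Measurable fun x => max (f n x - b) 0).aestronglyMeasurable
      (Eventually.of_forall fun x => ?_)
    rw [Real.norm_of_nonneg (le_max_right _ _)]
    have h1 := hM n x
    have h2 := abs_le.1 h1
    refine max_le ?_ (add_nonneg ((abs_nonneg _).trans h1) (abs_nonneg _))
    linarith [neg_abs_le b]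
  rw [← integral_const_mul, ← integral_add (hw.const_mul b) hpw]
  refine integral_mono hfw ((hw.const_mul b).add hpw) fun x => ?_
  have := mul_le_mul_of_nonneg_right (le_max_left (f n x - b) 0) (hw0 x)
  simp only
  linarith

/-- Points with mass on the side of `s` selected by the sign `e`. -/
def sidedSupport (G : Measure ℝ) (e : ℝ) : Set ℝ :=
  {s | ∀ δ > 0, G {x | 0 ≤ e * (s - x) ∧ e * (s - x) ≤ δ} ≠ 0}

/-- The set in question is an interval. By inner regularity it suffices to treat a compact subset,
which is covered by the two null intervals joining `q` to its least and greatest elements. -/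
lemma measure_setOf_uIcc_null (G : Measure ℝ) [IsFiniteMeasure G] (q : ℝ) :
    G {s | G (Set.uIcc q s) = 0} = 0 := by
  have hord : Set.OrdConnected {s | G (Set.uIcc q s) = 0} := by
    refine ⟨fun s₁ h₁ s₂ h₂ s hs => ?_⟩
    refine measure_mono_null (t := Set.uIcc q s₁ ∪ Set.uIcc q s₂) ?_ (measure_union_null h₁ h₂)
    intro x hx
    rw [Set.mem_union, Set.mem_uIcc, Set.mem_uIcc]
    rw [Set.mem_uIcc] at hx
    rcases hx with hx | hx
    · exact Or.inr (Or.inl ⟨hx.1, hx.2.trans hs.2⟩)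
    · exact Or.inl (Or.inr ⟨hs.1.trans hx.1, hx.2⟩)
  rw [hord.measurableSet.measure_eq_iSup_isCompact]
  simp only [ENNReal.iSup_eq_zero]
  intro K hK hKc
  rcases K.eq_empty_or_nonempty with rfl | hne
  · simp
  obtain ⟨a, ha, hamin⟩ := hKc.exists_isLeast hne
  obtain ⟨b, hb, hbmax⟩ := hKc.exists_isGreatest hne
  refine measure_mono_null (t := Set.uIcc q a ∪ Set.uIcc q b) ?_
    (measure_union_null (hK ha) (hK hb))
  intro x hx
  rw [Set.mem_union, Set.mem_uIcc, Set.mem_uIcc]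
  rcases le_total q x with h | h
  · exact Or.inr (Or.inl ⟨h, hbmax hx⟩)
  · exact Or.inl (Or.inr ⟨hamin hx, h⟩)

/-- An exceptional point is an endpoint of a null interval of positive length, which contains a
rational; this leaves countably many null sets. -/
lemma measure_compl_sidedSupport (G : Measure ℝ) [IsFiniteMeasure G] {e : ℝ}
    (he : e = 1 ∨ e = -1) : G (sidedSupport G e)ᶜ = 0 := by
  refine measure_mono_null (t := ⋃ q : ℚ, {s | G (Set.uIcc (q : ℝ) s) = 0}) ?_
    (measure_iUnion_null fun q => measure_setOf_uIcc_null G q)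
  intro s hs
  simp only [sidedSupport, Set.mem_compl_iff, Set.mem_ofPred_eq, not_forall, not_not] at hs
  obtain ⟨δ, hδ, h⟩ := hs
  rw [Set.mem_iUnion]
  rcases he with rfl | rfl
  · obtain ⟨q, hq1, hq2⟩ := exists_rat_btwn (sub_lt_self s hδ)
    refine ⟨q, measure_mono_null (fun x hx => ?_) h⟩
    rw [Set.uIcc_of_le hq2.le] at hx
    exact ⟨by linarith [hx.2], by linarith [hx.1]⟩
  · obtain ⟨q, hq1, hq2⟩ := exists_rat_btwn (lt_add_of_pos_right s hδ)
    refine ⟨q, measure_mono_null (fun x hx => ?_) h⟩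
    rw [Set.uIcc_of_ge hq1.le] at hx
    exact ⟨by linarith [hx.1], by linarith [hx.2]⟩

/-- A set of full measure for an atomless law on the positive half-line contains arbitrarily close
pairs of positive points. -/
lemma exists_close_pair {G : Measure ℝ} [IsProbabilityMeasure G] [NullSingletonClass G]
    (h0 : G (Set.Iic 0) = 0) {S : Set ℝ} (hS : G Sᶜ = 0) {ε : ℝ} (hε : 0 < ε) :
    ∃ a ∈ S, ∃ b ∈ S, 0 < a ∧ a < b ∧ b - a < ε := by
  by_contra hcon
  -- Without a close pair, each cell of length `ε` holds at most one positive point of `S`, hence no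
  -- mass.
  have hnull (n : ℤ) : G (Set.Ioc (n • ε) ((n + 1) • ε)) = 0 := by
    have hsub : (S ∩ Set.Ioi 0 ∩ Set.Ioc (n • ε) ((n + 1) • ε)).Subsingleton := by
      by_contra hns
      obtain ⟨a, ha, b, hb, hab⟩ := (Set.not_subsingleton_iff.1 hns).exists_lt
      refine hcon ⟨a, ha.1.1, b, hb.1.1, ha.1.2, hab, ?_⟩
      have h1 := ha.2.1
      have h2 := hb.2.2
      rw [add_smul, one_smul] at h2
      linarith
    refine measure_mono_null (t := (S ∩ Set.Ioi 0 ∩ Set.Ioc (n • ε) ((n + 1) • ε)) ∪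
      (Sᶜ ∪ Set.Iic 0)) (fun x hx => ?_)
      (measure_union_null (hsub.measure_zero G) (measure_union_null hS h0))
    by_cases hxS : x ∈ S
    · rcases le_or_gt x 0 with h | h
      · exact Or.inr (Or.inr h)
      · exact Or.inl ⟨⟨hxS, h⟩, hx⟩
    · exact Or.inr (Or.inl hxS)
  have huniv : G Set.univ = 0 := by
    rw [← iUnion_Ioc_zsmul hε]
    exact measure_iUnion_null hnull
  rw [measure_univ] at huniv
  exact one_ne_zero huniv

/-- A set closed under two translations of slightly different positive lengths is eventually
dense up to the difference of these lengths. -/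
lemma eventually_dense_of_add_mem {R : Set ℝ} {a b : ℝ} (h0 : 0 ∈ R) (ha : ∀ s ∈ R, s + a ∈ R)
    (hb : ∀ s ∈ R, s + b ∈ R) (hapos : 0 < a) (hab : a < b) :
    ∃ y₀ : ℝ, ∀ y ≥ y₀, ∃ s ∈ R, s ≤ y ∧ y - (b - a) ≤ s := by
  have hmem (i j : ℕ) : (i : ℝ) * a + j * b ∈ R := by
    have hi : (i : ℝ) * a ∈ R := by
      induction i with
      | zero => simpa using h0
      | succ i ih => have := ha _ ih; push_cast; convert this using 1; ring
    induction j with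
    | zero => simpa using hi
    | succ j ih => have := hb _ ih; push_cast; convert this using 1; ring
  set d := b - a with hd
  have hdpos : 0 < d := sub_pos.2 hab
  -- Once `m ≥ n`, one has `m * d ≥ a`, so the points `(m - j) * a + j * b = m * a + j * d` with `j
  -- ≤ m` cross `[m * a, (m + 1) * a]` in steps of `d`.
  obtain ⟨n, hn⟩ := exists_nat_ge (a / d)
  rw [div_le_iff₀ hdpos] at hn
  refine ⟨n * a, fun y hy => ?_⟩
  have hy0 : 0 ≤ y := le_trans (by positivity) hy
  set m := ⌊y / a⌋₊ with hm
  have hm1 : (m : ℝ) * a ≤ y := by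
    have := Nat.floor_le (div_nonneg hy0 hapos.le)
    rwa [le_div_iff₀ hapos] at this
  have hm2 : y < (m + 1) * a := by
    have := Nat.lt_floor_add_one (y / a)
    rwa [div_lt_iff₀ hapos] at this
  have hnm : n ≤ m := Nat.le_floor (by rwa [le_div_iff₀ hapos])
  have hnm' : (n : ℝ) ≤ m := by exact_mod_cast hnm
  set j := ⌊(y - m * a) / d⌋₊ with hj
  have hj0 : 0 ≤ (y - m * a) / d := div_nonneg (by linarith) hdpos.le
  have hj1 : (j : ℝ) * d ≤ y - m * a := by
    have := Nat.floor_le hj0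
    rwa [le_div_iff₀ hdpos] at this
  have hj2 : y - m * a < (j + 1) * d := by
    have := Nat.lt_floor_add_one ((y - m * a) / d)
    rwa [div_lt_iff₀ hdpos] at this
  have hjm : j ≤ m := by
    have h1 : (j : ℝ) * d ≤ m * d := by
      have := mul_le_mul_of_nonneg_right hnm' hdpos.le
      linarith
    exact_mod_cast le_of_mul_le_mul_right h1 hdpos
  have he : ((m - j : ℕ) : ℝ) * a + j * b = m * a + j * d := by
    rw [Nat.cast_sub hjm, hd]; ring
  refine ⟨_, hmem (m - j) j, ?_, ?_⟩ <;> rw [he] <;> linarith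

/-- Realizes the upper limit along a sequence, as the dominated convergence arguments require. -/
lemma exists_seq_tendsto_limsup {y : ℝ → ℝ} {M : ℝ} (hM : ∀ u, |y u| ≤ M) :
    ∃ β, (∀ ε > 0, ∀ᶠ u in atTop, y u ≤ β + ε) ∧
      ∃ t : ℕ → ℝ, Tendsto t atTop atTop ∧ Tendsto (fun n => y (t n)) atTop (𝓝 β) := by
  have hbdd : IsBoundedUnder (· ≤ ·) atTop y :=
    isBoundedUnder_of ⟨M, fun u => (abs_le.1 (hM u)).2⟩
  have hcob : IsCoboundedUnder (· ≤ ·) atTop y :=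
    (isBoundedUnder_of (r := (· ≥ ·)) ⟨-M, fun u => (abs_le.1 (hM u)).1⟩).isCoboundedUnder_le
  refine ⟨limsup y atTop, fun ε hε => ?_, ?_⟩
  · exact (eventually_lt_of_limsup_lt (lt_add_of_pos_right _ hε) hbdd).mono fun _ h => h.le
  · have hfreq (n : ℕ) : ∃ u ≥ (n : ℝ), limsup y atTop - 1 / ((n : ℝ) + 1) < y u := by
      have h := frequently_lt_of_lt_limsup hcob
        (sub_lt_self (limsup y atTop) (Nat.one_div_pos_of_nat (α := ℝ) (n := n)))
      obtain ⟨u, hu, hu'⟩ := (frequently_atTop.1 h) n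
      exact ⟨u, hu, hu'⟩
    choose t ht hyt using hfreq
    have htop : Tendsto t atTop atTop := tendsto_atTop_mono ht tendsto_natCast_atTop_atTop
    refine ⟨t, htop, ?_⟩
    rw [Metric.tendsto_atTop']
    intro ε hε
    have h1 := htop.eventually
      (eventually_lt_of_limsup_lt (lt_add_of_pos_right (limsup y atTop) hε) hbdd)
    have h2 := (tendsto_one_div_add_atTop_nhds_zero_nat (𝕜 := ℝ)).eventually (gt_mem_nhds hε)
    obtain ⟨N, hN⟩ := eventually_atTop.1 (h1.and h2)
    refine ⟨N, fun n hn => ?_⟩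
    obtain ⟨h3, h4⟩ := hN n hn.le
    rw [Real.dist_eq, abs_lt]
    constructor <;> linarith [hyt n]

/-- The one-sided half of the key renewal theorem: a bounded approximate solution `y` of the
renewal equation that is slowly oscillating in the direction `e` has its upper limit bounded by
the limit of its averages against an integrable weight. -/
theorem eventually_le_of_renewal {G : Measure ℝ} [IsProbabilityMeasure G] [NullSingletonClass G]
    (h0 : G (Set.Iic 0) = 0) {y w : ℝ → ℝ} {e C M : ℝ} (he : e = 1 ∨ e = -1)
    (hy : Measurable y) (hM : ∀ u, |y u| ≤ M)
    (hslow : ∀ ε > 0, ∃ δ > 0, ∀ s ≥ 0, ∀ t ≥ 0, 0 ≤ e * (t - s) → e * (t - s) ≤ δ →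
      y t ≤ y s + ε)
    (hren : Tendsto (fun u => y u - ∫ x, y (u - x) ∂G) atTop (𝓝 0))
    (hw : Integrable w (volume.restrict (Set.Ioi 0))) (hw0 : ∀ x, 0 ≤ w x)
    (hwpos : 0 < ∫ x in Set.Ioi 0, w x)
    (hC : Tendsto (fun T => ∫ x in Set.Ioi 0, y (T - x) * w x) atTop (𝓝 C)) :
    ∀ ε > 0, ∀ᶠ u in atTop, y u ≤ C / (∫ x in Set.Ioi 0, w x) + ε := by
  obtain ⟨β, hβ, t, ht, hyt⟩ := exists_seq_tendsto_limsup hM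
  set μ := ∫ x in Set.Ioi 0, w x with hμ
  suffices hle : β ≤ C / μ from fun ε hε => (hβ ε hε).mono fun u hu => by linarith
  -- The lags `s` at which `y` still attains its upper limit along `t n`.
  let R : Set ℝ := {s | Tendsto (fun n => y (t n - s)) atTop (𝓝 β)}
  have hR0 : 0 ∈ R := by simpa [R] using hyt
  have hshift (s : ℝ) : Tendsto (fun n => t n - s) atTop atTop :=
    tendsto_atTop_add_const_right _ (-s) ht
  -- The average of `y (t n - s - x)` over `G` tends to the maximal value `β`, so convergence holds
  -- in mean. A value below `β - ε` at `x = a` would, by slow oscillation, force values below `β - ε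
  -- / 2` for all `x` in a one-sided neighbourhood of `a`, which has positive mass.
  have hRadd (a : ℝ) (ha : a ∈ sidedSupport G e) (s : ℝ) (hs : s ∈ R) : s + a ∈ R := by
    have hup (x : ℝ) (ε : ℝ) (hε : ε > 0) : ∀ᶠ n in atTop, y (t n - s - x) ≤ β + ε := by
      have := (hshift (s + x)).eventually (hβ ε hε)
      simpa only [sub_add_eq_sub_sub] using this
    have hmean : Tendsto (fun n => ∫ x, y (t n - s - x) ∂G) atTop (𝓝 β) := by
      have h1 := hs.sub (hren.comp (hshift s))
      simpa using h1
    have hL1 := tendsto_integral_abs_sub_of_limsup_le (f := fun n x => y (t n - s - x))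
      (fun n => hy.comp (measurable_const.sub measurable_id)) (fun n x => hM _) hup hmean
    change Tendsto (fun n => y (t n - (s + a))) atTop (𝓝 β)
    rw [Metric.tendsto_nhds]
    intro ε hε
    obtain ⟨δ, hδ, hslow'⟩ := hslow (ε / 2) (half_pos hε)
    set E := {x | 0 ≤ e * (a - x) ∧ e * (a - x) ≤ δ} with hE
    have hEpos : 0 < G.real E := ENNReal.toReal_pos (ha δ hδ) (measure_ne_top G E)
    have hEm : MeasurableSet E := by
      change MeasurableSet ({x | 0 ≤ e * (a - x)} ∩ {x | e * (a - x) ≤ δ})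
      refine MeasurableSet.inter (measurableSet_le ?_ ?_) (measurableSet_le ?_ ?_) <;> fun_prop
    have hsmall := hL1.eventually (gt_mem_nhds (show 0 < ε / 2 * G.real E by positivity))
    have hbig := (hshift (s + a)).eventually (eventually_ge_atTop δ)
    filter_upwards [hup a (ε / 2) (half_pos hε), hsmall, hbig] with n h1 h2 h3
    rw [← sub_sub] at h3 ⊢
    rw [Real.dist_eq, abs_lt]
    refine ⟨?_, by linarith⟩
    by_contra hlow
    have hEle : ∀ x ∈ E, ε / 2 ≤ |y (t n - s - x) - β| := by
      intro x hx
      have h4 : 0 ≤ t n - s - x := by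
        rcases he with rfl | rfl
        · linarith [hx.1]
        · linarith [hx.2]
      have h5 := hslow' (t n - s - a) (hδ.le.trans h3) (t n - s - x) h4
        (by convert hx.1 using 2; ring) (by convert hx.2 using 2; ring)
      rw [abs_of_nonpos] <;> linarith
    have hmeas : Measurable fun x => |y (t n - s - x) - β| :=
      ((hy.comp (measurable_const.sub measurable_id)).sub_const β).abs
    have hint : Integrable (fun x => |y (t n - s - x) - β|) G :=
      integrable_of_forall_abs_le (M := M + |β|) hmeas fun x => by
        rw [abs_abs]; exact (abs_sub _ _).trans (add_le_add_left (hM _) _)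
    have h6 : ε / 2 * G.real E ≤ ∫ x, |y (t n - s - x) - β| ∂G := by
      calc ε / 2 * G.real E = ∫ _ in E, ε / 2 ∂G := by simp [mul_comm]
        _ ≤ ∫ x in E, |y (t n - s - x) - β| ∂G :=
            setIntegral_mono_on (integrable_const _) hint.integrableOn hEm hEle
        _ ≤ ∫ x, |y (t n - s - x) - β| ∂G :=
            setIntegral_le_integral hint (Eventually.of_forall fun x => abs_nonneg _)
    exact h6.not_gt h2
  refine le_of_forall_pos_le_add fun ε hε => ?_
  obtain ⟨δ, hδ, hslow'⟩ := hslow (ε / 2) (half_pos hε)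
  obtain ⟨a, ha, b, hb, hapos, hab, hdiff⟩ :=
    exists_close_pair h0 (measure_compl_sidedSupport G he) hδ
  obtain ⟨y₀, hy₀⟩ := eventually_dense_of_add_mem hR0 (hRadd a ha) (hRadd b hb) hapos hab
  have hdense : ∀ v ≥ y₀, ∃ s ∈ R, 0 ≤ e * (v - s) ∧ e * (v - s) ≤ δ := by
    intro v hv
    rcases he with rfl | rfl
    · obtain ⟨s, hs, h1, h2⟩ := hy₀ v hv
      exact ⟨s, hs, by linarith, by linarith⟩
    -- For `e = -1` a point to the right of `v` is needed, hence the shift by `b - a`.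
    · obtain ⟨s, hs, h1, h2⟩ := hy₀ (v + (b - a)) (by linarith)
      exact ⟨s, hs, by linarith, by linarith⟩
  have hlow : ∀ v ≥ y₀, ∀ᶠ n in atTop, β - ε ≤ y (t n - v) := by
    intro v hv
    obtain ⟨s, hs, h1, h2⟩ := hdense v hv
    have hs' : Tendsto (fun n => y (t n - s)) atTop (𝓝 β) := hs
    filter_upwards [hs'.eventually (lt_mem_nhds (show β - ε / 2 < β by linarith)),
      (hshift s).eventually (eventually_ge_atTop 0), (hshift v).eventually (eventually_ge_atTop 0)]
      with n h3 h4 h5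
    have := hslow' (t n - v) h5 (t n - s) h4 (by convert h1 using 2; ring)
      (by convert h2 using 2; ring)
    linarith
  -- Reverse Fatou for `-y` yields `(β - ε) * μ ≤ C`. The truncation `max x 0` provides the
  -- upper-limit bound at every real `x` and changes nothing on the domain of integration.
  have hfin := le_mul_integral_of_limsup_le (ν := volume.restrict (Set.Ioi (0 : ℝ)))
    (f := fun n x => -y (t n - y₀ - max x 0)) (b := -(β - ε)) (C := -C) (M := M)
    (fun n => by fun_prop) (fun n x => by rw [abs_neg]; exact hM _) hw hw0 ?_ ?_
  · rw [← hμ] at hfin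
    have : (β - ε) * μ ≤ C := by linarith
    rw [← le_div_iff₀ hwpos] at this
    linarith
  · intro x η hη
    filter_upwards [hlow (y₀ + max x 0) (le_add_of_nonneg_right (le_max_right x 0))] with n hn
    rw [← sub_sub] at hn
    linarith
  · have h1 := (hC.comp (hshift y₀)).neg
    refine h1.congr fun n => ?_
    simp only [Function.comp_apply]
    rw [← integral_neg]
    refine setIntegral_congr_fun measurableSet_Ioi fun x hx => ?_
    simp only [max_eq_left (Set.mem_Ioi.1 hx).le, neg_mul]

end Renewal

/-! ### Exponential tilting and Cramér-Lundberg asymptotics -/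

section CramerLundberg

/-- The integrated renewal equation. -/
lemma lintegral_mul_tail_of_renewal {G : Measure ℝ} [IsProbabilityMeasure G]
    (h0 : G (Set.Iic 0) = 0) {z g : ℝ → ℝ≥0∞} (hz : Measurable z) (hg : Measurable g)
    (hren : ∀ u, z u = g u + ∫⁻ x, z (u - x) ∂G) (T : ℝ)
    (hfin : ∫⁻ s in Set.Iic T, z s ≠ ∞) :
    ∫⁻ y in Set.Ioi 0, z (T - y) * G (Set.Ioi y) = ∫⁻ s in Set.Iic T, g s := by
  have hIic : Measurable fun t => G (Set.Iic (T - t)) :=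
    Antitone.measurable fun s t h => measure_mono (Set.Iic_subset_Iic.2 (by linarith))
  -- Tonelli and translation invariance; for `t > T` the factor `G (Set.Iic (T - t))` vanishes since
  -- `G` lives on the positive half-line.
  have hconv : ∫⁻ s in Set.Iic T, ∫⁻ x, z (s - x) ∂G =
      ∫⁻ t in Set.Iic T, z t * G (Set.Iic (T - t)) := by
    have hind (s x : ℝ) : (Set.Iic T).indicator (fun s => z (s - x)) s =
        (fun t => (Set.Iic T).indicator 1 (t + x) * z t) (s - x) := by
      by_cases h : s ∈ Set.Iic T
      · simp [Set.indicator_of_mem h]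
      · simp [Set.indicator_of_notMem h]
    have hmeas : Measurable fun q : ℝ × ℝ =>
        (Set.Iic T).indicator (fun s => z (s - q.2)) q.1 := by
      have : Measurable fun q : ℝ × ℝ =>
          (Set.Iic T).indicator (1 : ℝ → ℝ≥0∞) q.1 * z (q.1 - q.2) :=
        ((measurable_one.indicator measurableSet_Iic).comp measurable_fst).mul
          (hz.comp (measurable_fst.sub measurable_snd))
      convert this using 2 with q
      by_cases h : q.1 ∈ Set.Iic T
      · simp [Set.indicator_of_mem h]
      · simp [Set.indicator_of_notMem h]
    have hmeas2 : Measurable fun q : ℝ × ℝ =>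
        (Set.Iic T).indicator (1 : ℝ → ℝ≥0∞) (q.2 + q.1) * z q.2 :=
      ((measurable_one.indicator measurableSet_Iic).comp
        (measurable_snd.add measurable_fst)).mul (hz.comp measurable_snd)
    calc ∫⁻ s in Set.Iic T, ∫⁻ x, z (s - x) ∂G
        = ∫⁻ s, ∫⁻ x, (Set.Iic T).indicator (fun s => z (s - x)) s ∂G := by
          rw [← lintegral_indicator measurableSet_Iic]
          refine lintegral_congr fun s => ?_
          by_cases h : s ∈ Set.Iic T
          · simp [Set.indicator_of_mem h]
          · simp [Set.indicator_of_notMem h]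
      _ = ∫⁻ x, ∫⁻ s, (Set.Iic T).indicator (fun s => z (s - x)) s ∂volume ∂G :=
          lintegral_lintegral_swap hmeas.aemeasurable
      _ = ∫⁻ x, ∫⁻ t, (Set.Iic T).indicator 1 (t + x) * z t ∂volume ∂G := by
          refine lintegral_congr fun x => ?_
          simp_rw [hind _ x]
          exact lintegral_sub_right_eq_self
            (fun t => (Set.Iic T).indicator (1 : ℝ → ℝ≥0∞) (t + x) * z t) x
      _ = ∫⁻ t, ∫⁻ x, (Set.Iic T).indicator 1 (t + x) * z t ∂G ∂volume :=
          lintegral_lintegral_swap hmeas2.aemeasurable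
      _ = ∫⁻ t, z t * G (Set.Iic (T - t)) := by
          refine lintegral_congr fun t => ?_
          have hpre (x : ℝ) : (Set.Iic T).indicator (1 : ℝ → ℝ≥0∞) (t + x) =
              (Set.Iic (T - t)).indicator 1 x := by
            by_cases h : x ∈ Set.Iic (T - t)
            · rw [Set.indicator_of_mem h, Set.indicator_of_mem]
              · rfl
              · rw [Set.mem_Iic] at h ⊢; linarith
            · rw [Set.indicator_of_notMem h, Set.indicator_of_notMem]
              rw [Set.mem_Iic] at h ⊢; intro h'; exact h (by linarith)
          simp_rw [hpre]
          rw [lintegral_mul_const _ (measurable_one.indicator measurableSet_Iic),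
            lintegral_indicator_one measurableSet_Iic, mul_comm]
      _ = ∫⁻ t in Set.Iic T, z t * G (Set.Iic (T - t)) := by
          rw [← lintegral_indicator measurableSet_Iic]
          refine lintegral_congr fun t => ?_
          by_cases h : t ∈ Set.Iic T
          · rw [Set.indicator_of_mem h]
          · rw [Set.indicator_of_notMem h, measure_mono_null (Set.Iic_subset_Iic.2 ?_) h0,
              mul_zero]
            rw [Set.mem_Iic] at h; linarith
  -- Splitting the mass of `G` at `T - t` and inserting the renewal equation give two decompositions
  -- of one integral with a common term, which is finite and cancels.
  have hsplit : ∫⁻ s in Set.Iic T, z s = (∫⁻ t in Set.Iic T, z t * G (Set.Iic (T - t))) +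
      ∫⁻ t in Set.Iic T, z t * G (Set.Ioi (T - t)) := by
    have hzI : Measurable fun t => z t * G (Set.Iic (T - t)) := hz.mul hIic
    rw [← lintegral_add_left hzI]
    refine lintegral_congr fun t => ?_
    rw [← mul_add, ← Set.compl_Iic, measure_add_measure_compl measurableSet_Iic, measure_univ,
      mul_one]
  have hsplit' : ∫⁻ s in Set.Iic T, z s = (∫⁻ t in Set.Iic T, z t * G (Set.Iic (T - t))) +
      ∫⁻ s in Set.Iic T, g s := by
    rw [← hconv, add_comm, ← lintegral_add_left hg]
    exact lintegral_congr fun s => hren s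
  have hne : ∫⁻ t in Set.Iic T, z t * G (Set.Iic (T - t)) ≠ ∞ := by
    refine ne_top_of_le_ne_top hfin ?_
    rw [hsplit]; exact le_self_add
  rw [← (ENNReal.add_right_inj hne).1 (hsplit.symm.trans hsplit'),
    ← lintegral_indicator measurableSet_Iic, setLIntegral_congr Ioi_ae_eq_Ici,
    ← lintegral_indicator measurableSet_Ici]
  refine Eq.trans ?_ (lintegral_sub_left_eq_self _ T)
  refine lintegral_congr fun y => ?_
  by_cases h : y ∈ Set.Ici (0 : ℝ)
  · rw [Set.indicator_of_mem h, Set.indicator_of_mem, sub_sub_cancel]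
    rw [Set.mem_Ici] at h; rw [Set.mem_Iic]; linarith
  · rw [Set.indicator_of_notMem h, Set.indicator_of_notMem]
    rw [Set.mem_Ici] at h; rw [Set.mem_Iic]; intro h'; exact h (by linarith)

/-- The exponentially tilted measure. -/
def tilt (F : Measure ℝ) (r : ℝ) : Measure ℝ :=
  F.withDensity fun x => ENNReal.ofReal (Real.exp (r * x))

variable {F : Measure ℝ} {r : ℝ}

lemma lintegral_tilt {f : ℝ → ℝ≥0∞} (hf : Measurable f) :
    ∫⁻ x, f x ∂tilt F r = ∫⁻ x, ENNReal.ofReal (Real.exp (r * x)) * f x ∂F :=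
  lintegral_withDensity_eq_lintegral_mul _ (by fun_prop) hf

lemma tilt_absolutelyContinuous : (tilt F r).AbsolutelyContinuous F :=
  withDensity_absolutelyContinuous _ _

lemma integral_tilt (f : ℝ → ℝ) :
    ∫ x, f x ∂tilt F r = ∫ x, Real.exp (r * x) * f x ∂F := by
  rw [tilt, integral_withDensity_eq_integral_toReal_smul (by fun_prop)
    (Eventually.of_forall fun _ => ENNReal.ofReal_lt_top)]
  simp [ENNReal.toReal_ofReal (Real.exp_pos _).le]

lemma integrable_tilt_iff {f : ℝ → ℝ} :
    Integrable f (tilt F r) ↔ Integrable (fun x => Real.exp (r * x) * f x) F := by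
  rw [tilt, integrable_withDensity_iff_integrable_smul' (by fun_prop)
    (Eventually.of_forall fun _ => ENNReal.ofReal_lt_top)]
  simp [ENNReal.toReal_ofReal (Real.exp_pos _).le]

/-- The function `u ↦ e^{r u} ψ(u)` on the nonnegative half-line, extended by zero. -/
def tiltFun (ψ : ℝ → ℝ≥0∞) (r u : ℝ) : ℝ≥0∞ :=
  (Set.Ici 0).indicator (fun u => ENNReal.ofReal (Real.exp (r * u)) * ψ u) u

lemma tiltFun_of_nonneg (ψ : ℝ → ℝ≥0∞) (r : ℝ) {u : ℝ} (hu : 0 ≤ u) :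
    tiltFun ψ r u = ENNReal.ofReal (Real.exp (r * u)) * ψ u :=
  Set.indicator_of_mem (Set.mem_Ici.2 hu) _

lemma tiltFun_of_neg (ψ : ℝ → ℝ≥0∞) (r : ℝ) {u : ℝ} (hu : u < 0) : tiltFun ψ r u = 0 :=
  Set.indicator_of_notMem (by simpa using hu) _

lemma measurable_tiltFun {ψ : ℝ → ℝ≥0∞} (hψ : Antitone ψ) : Measurable (tiltFun ψ r) :=
  Measurable.indicator (Measurable.mul (by fun_prop) hψ.measurable) measurableSet_Ici

lemma antitone_measure_Ioi (F : Measure ℝ) : Antitone fun u => F (Set.Ioi u) :=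
  fun _ _ h => measure_mono (Set.Ioi_subset_Ioi h)

/-- Multiply the defective equation by `e^{ru}`. The jumps `x > u`, where `ψ (u - x) = 1`, produce
the inhomogeneity; for `x ≤ u` the factorization `e^{ru} = e^{rx} e^{r(u - x)}` produces the tilted
convolution. -/
lemma tiltFun_renewal {ψ : ℝ → ℝ≥0∞} (h0 : F (Set.Iic 0) = 0) (hψ : Antitone ψ)
    (hneg : ∀ u < 0, ψ u = 1) (hren : ∀ u ≥ 0, ψ u = ∫⁻ x, ψ (u - x) ∂F) (u : ℝ) :
    tiltFun ψ r u =
      tiltFun (fun u => F (Set.Ioi u)) r u + ∫⁻ x, tiltFun ψ r (u - x) ∂tilt F r := by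
  have hm : Measurable fun x => tiltFun ψ r (u - x) :=
    (measurable_tiltFun hψ).comp (measurable_const.sub measurable_id)
  have hm' : Measurable fun x => ψ (u - x) :=
    hψ.measurable.comp (measurable_const.sub measurable_id)
  rw [lintegral_tilt hm]
  have hae : ∀ᵐ x ∂F, 0 < x := by
    rw [ae_iff]; simp only [not_lt]; exact h0
  rcases lt_or_ge u 0 with hu | hu
  · rw [tiltFun_of_neg _ _ hu, tiltFun_of_neg _ _ hu, zero_add, eq_comm,
      lintegral_eq_zero_iff' (by fun_prop)]
    filter_upwards [hae] with x hx
    rw [tiltFun_of_neg _ _ (by linarith), mul_zero]; rfl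
  · rw [tiltFun_of_nonneg _ _ hu, tiltFun_of_nonneg _ _ hu, hren u hu,
      ← lintegral_add_compl _ (measurableSet_Ioi (a := u)), mul_add]
    congr 1
    · congr 1
      rw [← setLIntegral_one]
      exact setLIntegral_congr_fun measurableSet_Ioi fun x hx =>
        hneg _ (sub_neg.2 (Set.mem_Ioi.1 hx))
    · rw [← lintegral_const_mul _ hm', ← lintegral_indicator measurableSet_Ioi.compl]
      refine lintegral_congr fun x => ?_
      by_cases h : x ≤ u
      · rw [Set.indicator_of_mem (by simpa using h), tiltFun_of_nonneg _ _ (sub_nonneg.2 h),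
          ← mul_assoc, ← ENNReal.ofReal_mul (Real.exp_pos _).le, ← Real.exp_add]
        ring_nf
      · rw [Set.indicator_of_notMem (by simpa using h), tiltFun_of_neg _ _ (by linarith),
          mul_zero]

/-- On `x > u` one has `e^{ru} ≤ e^{rx}`. This makes the inhomogeneity vanish at infinity and also
feeds the Lundberg bound. -/
lemma tiltFun_tail_le (hr : 0 < r) (u : ℝ) :
    tiltFun (fun u => F (Set.Ioi u)) r u ≤ tilt F r (Set.Ioi u) := by
  rcases lt_or_ge u 0 with hu | hu
  · rw [tiltFun_of_neg _ _ hu]; exact zero_le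
  · rw [tiltFun_of_nonneg _ _ hu, tilt, withDensity_apply _ measurableSet_Ioi,
      ← setLIntegral_const]
    refine setLIntegral_mono (by fun_prop) fun x hx => ENNReal.ofReal_le_ofReal ?_
    exact Real.exp_le_exp.2 (mul_le_mul_of_nonneg_left (Set.mem_Ioi.1 hx).le hr.le)

/-- The Lundberg bound. -/
lemma tiltFun_le_one {ψ : ℝ → ℝ≥0∞} (h0 : F (Set.Iic 0) = 0) (hr : 0 < r)
    (hF : ∫⁻ x, ENNReal.ofReal (Real.exp (r * x)) ∂F = 1) (hψ : Antitone ψ) (hle : ∀ u, ψ u ≤ 1)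
    (hneg : ∀ u < 0, ψ u = 1) (hren : ∀ u ≥ 0, ψ u = ∫⁻ x, ψ (u - x) ∂F) (u : ℝ) :
    tiltFun ψ r u ≤ 1 := by
  have hprob : IsProbabilityMeasure (tilt F r) :=
    ⟨by rw [tilt, withDensity_apply _ MeasurableSet.univ, Measure.restrict_univ, hF]⟩
  have hG0 : tilt F r (Set.Iic 0) = 0 := tilt_absolutelyContinuous h0
  have hexp (u : ℝ) : tiltFun ψ r u ≤ ENNReal.ofReal (Real.exp (r * u)) := by
    rcases lt_or_ge u 0 with hu | hu
    · rw [tiltFun_of_neg _ _ hu]; exact zero_le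
    · rw [tiltFun_of_nonneg _ _ hu]
      exact mul_le_of_le_one_right' (hle u)
  -- The excess over `1` is subinvariant: the inhomogeneity is at most the tilted mass beyond `u`,
  -- and the convolution at most the mass up to `u` plus the averaged excess.
  refine tsub_eq_zero_iff_le.1 (eq_zero_of_le_lintegral_sub (G := tilt F r) (c := r)
    (v := fun u => tiltFun ψ r u - 1) (fun u => tsub_le_self.trans (hexp u)) (fun u => ?_)
    (lintegral_exp_neg_lt_one hG0 hr) u)
  rw [tsub_le_iff_left, tiltFun_renewal h0 hψ hneg hren]
  have hm : Measurable fun x => tiltFun ψ r (u - x) - 1 :=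
    ((measurable_tiltFun hψ).comp (measurable_const.sub measurable_id)).sub measurable_const
  have h1 : ∫⁻ x, tiltFun ψ r (u - x) ∂tilt F r ≤
      tilt F r (Set.Iic u) + ∫⁻ x, (tiltFun ψ r (u - x) - 1) ∂tilt F r := by
    rw [← lintegral_indicator_one measurableSet_Iic, ← lintegral_add_right _ hm]
    refine lintegral_mono fun x => ?_
    by_cases h : x ≤ u
    · rw [Set.indicator_of_mem (Set.mem_Iic.2 h)]
      exact le_add_tsub
    · rw [tiltFun_of_neg _ _ (by linarith)]; exact zero_le
  calc _ ≤ tilt F r (Set.Ioi u) +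
        (tilt F r (Set.Iic u) + ∫⁻ x, (tiltFun ψ r (u - x) - 1) ∂tilt F r) :=
        add_le_add (tiltFun_tail_le hr u) h1
    _ = _ := by
        rw [← add_assoc, add_comm (tilt F r (Set.Ioi u)), ← Set.compl_Iic,
          measure_add_measure_compl measurableSet_Iic, measure_univ]

/-- The layer-cake formula turns the integral into `∫ (e^{rx} - 1) / r dF`. This is the numerator of
the limiting constant. -/
lemma lintegral_tiltFun_tail [IsFiniteMeasure F] (h0 : F (Set.Iic 0) = 0) (hr : 0 < r)
    (hF : ∫⁻ x, ENNReal.ofReal (Real.exp (r * x)) ∂F = 1) :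
    ∫⁻ u, tiltFun (fun u => F (Set.Ioi u)) r u =
      ENNReal.ofReal ((1 - F.real Set.univ) / r) := by
  have hae : ∀ᵐ x ∂F, 0 < x := by
    rw [ae_iff]; simp only [not_lt]; exact h0
  have hexp : Integrable (fun x => Real.exp (r * x)) F := by
    refine ⟨by fun_prop, ?_⟩
    rw [hasFiniteIntegral_iff_ofReal (Eventually.of_forall fun x => (Real.exp_pos _).le), hF]
    exact ENNReal.one_lt_top
  have hint : ∫ x, Real.exp (r * x) ∂F = 1 := by
    rw [integral_eq_lintegral_of_nonneg_ae (Eventually.of_forall fun x => (Real.exp_pos _).le)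
      (by fun_prop), hF, ENNReal.toReal_one]
  have hlayer := lintegral_comp_eq_lintegral_meas_lt_mul (f := fun x : ℝ => x)
    (g := fun t => Real.exp (r * t)) F (hae.mono fun x hx => hx.le) (by fun_prop)
    (fun t _ => (by fun_prop : Continuous fun t => Real.exp (r * t)).intervalIntegrable _ _)
    (Eventually.of_forall fun t => (Real.exp_pos _).le)
  have hprim (x : ℝ) : ∫ t in (0 : ℝ)..x, Real.exp (r * t) = (Real.exp (r * x) - 1) / r := by
    rw [intervalIntegral.integral_comp_mul_left (fun t => Real.exp t) hr.ne', integral_exp]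
    simp [div_eq_inv_mul]
  simp only [hprim] at hlayer
  have hlhs : ∫⁻ x, ENNReal.ofReal ((Real.exp (r * x) - 1) / r) ∂F =
      ENNReal.ofReal ((1 - F.real Set.univ) / r) := by
    have hi : Integrable (fun x => (Real.exp (r * x) - 1) / r) F :=
      (hexp.sub (integrable_const 1)).div_const r
    rw [← ofReal_integral_eq_lintegral_ofReal hi]
    · rw [integral_div, integral_sub hexp (integrable_const 1), hint]
      simp
    · filter_upwards [hae] with x hx
      exact div_nonneg (sub_nonneg.2 (Real.one_le_exp (by positivity))) hr.le
  rw [← hlhs, hlayer, setLIntegral_congr Ioi_ae_eq_Ici, ← lintegral_indicator measurableSet_Ici]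
  refine lintegral_congr fun u => ?_
  simp only [tiltFun]
  congr 1
  funext t
  rw [mul_comm]
  rfl

/-- Cramér-Lundberg asymptotics for the solution of a defective renewal equation. -/
theorem tendsto_exp_mul_of_defective_renewal [IsFiniteMeasure F] [NullSingletonClass F]
    {ψ : ℝ → ℝ≥0∞} (h0 : F (Set.Iic 0) = 0) (hr : 0 < r)
    (hF : ∫⁻ x, ENNReal.ofReal (Real.exp (r * x)) ∂F = 1)
    (hint : Integrable (fun x => x * Real.exp (r * x)) F) (hψ : Antitone ψ)
    (hle : ∀ u, ψ u ≤ 1) (hneg : ∀ u < 0, ψ u = 1)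
    (hren : ∀ u ≥ 0, ψ u = ∫⁻ x, ψ (u - x) ∂F) :
    0 < ∫ x, x * Real.exp (r * x) ∂F ∧
    Tendsto (fun u => Real.exp (r * u) * (ψ u).toReal) atTop
      (𝓝 ((1 - F.real Set.univ) / (r * ∫ x, x * Real.exp (r * x) ∂F))) := by
  set G := tilt F r with hG
  have hprob : IsProbabilityMeasure G :=
    ⟨by rw [hG, tilt, withDensity_apply _ MeasurableSet.univ, Measure.restrict_univ, hF]⟩
  have hG0 : G (Set.Iic 0) = 0 := tilt_absolutelyContinuous h0
  have hGna : NullSingletonClass G := ⟨fun x => tilt_absolutelyContinuous (measure_singleton x)⟩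
  have hGae : ∀ᵐ x ∂G, 0 < x := by
    rw [ae_iff]; simp only [not_lt]; exact hG0
  have hGint : Integrable (fun x => x) G :=
    integrable_tilt_iff.2 (by simpa only [mul_comm] using hint)
  have hmean : ∫ x, x * Real.exp (r * x) ∂F = ∫ x, x ∂G := by
    rw [hG, integral_tilt]; simp only [mul_comm]
  have hmeanpos : 0 < ∫ x, x ∂G := by
    rw [integral_pos_iff_support_of_nonneg_ae (hGae.mono fun x hx => hx.le) hGint]
    have hsupp : Function.support (fun x : ℝ => x) = {0}ᶜ := by ext x; simp
    rw [hsupp, (prob_compl_eq_one_iff (measurableSet_singleton 0)).2 (measure_singleton 0)]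
    exact one_pos
  set z : ℝ → ℝ := fun u => (tiltFun ψ r u).toReal with hzdef
  have hzle (u : ℝ) : tiltFun ψ r u ≤ 1 := tiltFun_le_one h0 hr hF hψ hle hneg hren u
  have hzfin (u : ℝ) : tiltFun ψ r u ≠ ∞ := ((hzle u).trans_lt ENNReal.one_lt_top).ne
  have hzm : Measurable z := (measurable_tiltFun hψ).ennreal_toReal
  have hzbd (u : ℝ) : |z u| ≤ 1 := by
    rw [abs_of_nonneg ENNReal.toReal_nonneg]
    exact ENNReal.toReal_le_of_le_ofReal zero_le_one (by simpa using hzle u)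
  have hz_nonneg {u : ℝ} (hu : 0 ≤ u) : z u = Real.exp (r * u) * (ψ u).toReal := by
    simp only [hzdef]
    rw [tiltFun_of_nonneg _ _ hu, ENNReal.toReal_mul, ENNReal.toReal_ofReal (Real.exp_pos _).le]
  set g := tiltFun (fun u => F (Set.Ioi u)) r with hg
  have hgle (u : ℝ) : g u ≤ G (Set.Ioi u) := tiltFun_tail_le hr u
  have hgm : Measurable g := measurable_tiltFun (antitone_measure_Ioi F)
  have hzren (u : ℝ) : tiltFun ψ r u = g u + ∫⁻ x, tiltFun ψ r (u - x) ∂G :=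
    tiltFun_renewal h0 hψ hneg hren u
  -- the inhomogeneity of the renewal equation vanishes at infinity
  have hren_real : Tendsto (fun u => z u - ∫ x, z (u - x) ∂G) atTop (𝓝 0) := by
    have heq (u : ℝ) : z u - ∫ x, z (u - x) ∂G = (g u).toReal := by
      have hzum : Measurable fun x => z (u - x) := hzm.comp (measurable_const.sub measurable_id)
      have h1 : ∫ x, z (u - x) ∂G = (∫⁻ x, tiltFun ψ r (u - x) ∂G).toReal := by
        rw [integral_eq_lintegral_of_nonneg_ae
          (Eventually.of_forall fun x => ENNReal.toReal_nonneg) hzum.aestronglyMeasurable]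
        congr 1
        exact lintegral_congr fun x => ENNReal.ofReal_toReal (hzfin _)
      have hfin := hzfin u
      rw [hzren u] at hfin
      rw [h1, hzdef]
      simp only
      rw [hzren u, ENNReal.toReal_add (ne_top_of_le_ne_top hfin le_self_add)
        (ne_top_of_le_ne_top hfin le_add_self)]
      ring
    simp_rw [heq]
    have hcdf : Tendsto (fun u => (G (Set.Ioi u)).toReal) atTop (𝓝 0) := by
      have h1 := (tendsto_cdf_atTop G).const_sub 1
      rw [sub_self] at h1
      refine h1.congr fun u => ?_
      rw [cdf_eq_real, ← probReal_compl_eq_one_sub measurableSet_Iic, Set.compl_Iic]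
      rfl
    exact squeeze_zero (fun _ => ENNReal.toReal_nonneg)
      (fun u => ENNReal.toReal_mono (measure_ne_top _ _) (hgle u)) hcdf
  set w : ℝ → ℝ := fun x => G.real (Set.Ioi x) with hw
  have hwm : Measurable w := (antitone_measure_Ioi G).measurable.ennreal_toReal
  have hlayer : ∫⁻ t in Set.Ioi 0, G (Set.Ioi t) = ∫⁻ x, ENNReal.ofReal x ∂G :=
    (lintegral_eq_lintegral_meas_lt G (hGae.mono fun x hx => hx.le) (by fun_prop)).symm
  have hwint : Integrable w (volume.restrict (Set.Ioi 0)) := by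
    refine integrable_toReal_of_lintegral_ne_top
      (antitone_measure_Ioi G).measurable.aemeasurable ?_
    rw [hlayer]
    exact hGint.lintegral_lt_top.ne
  have hwmean : ∫ x in Set.Ioi 0, w x = ∫ x, x ∂G :=
    (hGint.integral_eq_integral_meas_lt (hGae.mono fun x hx => hx.le)).symm
  -- the averages of the solution against the tail of the tilted law converge
  have hC : Tendsto (fun T => ∫ x in Set.Ioi 0, z (T - x) * w x) atTop
      (𝓝 ((1 - F.real Set.univ) / r)) := by
    have htail := lintegral_tiltFun_tail h0 hr hF
    have hlim : Tendsto (fun T => ∫⁻ s in Set.Iic T, g s) atTop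
        (𝓝 (ENNReal.ofReal ((1 - F.real Set.univ) / r))) := by
      rw [← htail]
      exact (aecover_Iic tendsto_id).lintegral_tendsto_of_countably_generated hgm.aemeasurable
    have hmass : F.real Set.univ ≤ 1 := by
      refine ENNReal.toReal_le_of_le_ofReal zero_le_one ?_
      rw [ENNReal.ofReal_one, ← hF, ← lintegral_one]
      refine lintegral_mono_ae ?_
      have hae : ∀ᵐ x ∂F, 0 < x := by
        rw [ae_iff]; simp only [not_lt]; exact h0
      filter_upwards [hae] with x hx
      rw [ENNReal.one_le_ofReal]
      exact Real.one_le_exp (by positivity)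
    have hreal := (ENNReal.tendsto_toReal ENNReal.ofReal_ne_top).comp hlim
    rw [ENNReal.toReal_ofReal (div_nonneg (sub_nonneg.2 hmass) hr.le)] at hreal
    refine hreal.congr fun T => ?_
    have hfin : ∫⁻ s in Set.Iic T, tiltFun ψ r s ≠ ∞ := by
      have hb : ∫⁻ s in Set.Iic T, tiltFun ψ r s ≤ volume (Set.Icc 0 T) := by
        rw [← lintegral_indicator_one measurableSet_Icc, ← lintegral_indicator measurableSet_Iic]
        refine lintegral_mono fun s => ?_
        by_cases hs : s ∈ Set.Iic T
        · rw [Set.indicator_of_mem hs]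
          rcases lt_or_ge s 0 with hs0 | hs0
          · rw [tiltFun_of_neg _ _ hs0]; exact zero_le
          · rw [Set.indicator_of_mem (Set.mem_Icc.2 ⟨hs0, hs⟩)]; exact hzle s
        · rw [Set.indicator_of_notMem hs]; exact zero_le
      exact (hb.trans_lt (by simp)).ne
    simp only [Function.comp_apply]
    rw [← lintegral_mul_tail_of_renewal hG0 (measurable_tiltFun hψ) hgm hzren T hfin,
      integral_eq_lintegral_of_nonneg_ae]
    · congr 1
      refine lintegral_congr fun x => ?_
      simp only [hzdef, hw]
      rw [ENNReal.ofReal_mul ENNReal.toReal_nonneg, ENNReal.ofReal_toReal (hzfin _),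
        ofReal_measureReal]
    · exact Eventually.of_forall fun x => mul_nonneg ENNReal.toReal_nonneg measureReal_nonneg
    · exact ((hzm.comp (measurable_const.sub measurable_id)).mul hwm).aestronglyMeasurable
  -- As `ψ` is antitone, `z t ≤ e^{r(t - s)} z s` with `z ≤ 1`; the choice of `δ` makes the
  -- exponential at most `1 + ε`.
  have hslow (ε : ℝ) (hε : 0 < ε) : ∃ δ > 0, ∀ s ≥ 0, ∀ t ≥ 0, 0 ≤ t - s → t - s ≤ δ →
      z t ≤ z s + ε := by
    refine ⟨Real.log (1 + ε) / r, div_pos (Real.log_pos (by linarith)) hr, ?_⟩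
    intro s hs t ht h1 h2
    have h3 : Real.exp (r * (t - s)) ≤ 1 + ε := by
      rw [le_div_iff₀ hr] at h2
      rw [← Real.exp_log (show 0 < 1 + ε by linarith)]
      exact Real.exp_le_exp.2 (by linarith)
    have h4 : z t ≤ Real.exp (r * (t - s)) * z s := by
      rw [hz_nonneg hs, hz_nonneg ht, ← mul_assoc, ← Real.exp_add]
      have : r * (t - s) + r * s = r * t := by ring
      rw [this]
      refine mul_le_mul_of_nonneg_left ?_ (Real.exp_pos _).le
      exact ENNReal.toReal_mono ((hle s).trans_lt ENNReal.one_lt_top).ne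
        (hψ (sub_nonneg.1 h1))
    have h5 : 0 ≤ z s := ENNReal.toReal_nonneg
    have h6 : z s ≤ 1 := (le_abs_self _).trans (hzbd s)
    nlinarith
  have hwpos : 0 < ∫ x in Set.Ioi 0, w x := hwmean ▸ hmeanpos
  have hupper := eventually_le_of_renewal (e := 1) hG0 (Or.inl rfl) hzm hzbd
    (by simpa only [one_mul] using hslow) hren_real hwint (fun _ => measureReal_nonneg) hwpos hC
  -- Changing the sign of `z` reverses the direction of slow oscillation, hence `e = -1`.
  have hlower := eventually_le_of_renewal (e := -1) (y := fun u => -z u) hG0 (Or.inr rfl) hzm.neg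
    (fun u => by rw [abs_neg]; exact hzbd u) ?_ ?_ hwint (fun _ => measureReal_nonneg) hwpos
    (C := -((1 - F.real Set.univ) / r)) ?_
  · refine ⟨hmean ▸ hmeanpos, ?_⟩
    rw [hmean, ← div_div, ← hwmean]
    have hlim : Tendsto z atTop (𝓝 ((1 - F.real Set.univ) / r / ∫ x in Set.Ioi 0, w x)) := by
      rw [Metric.tendsto_nhds]
      intro ε hε
      filter_upwards [hupper (ε / 2) (half_pos hε), hlower (ε / 2) (half_pos hε)] with u h1 h2
      rw [neg_div] at h2
      rw [Real.dist_eq, abs_lt]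
      constructor <;> linarith
    refine hlim.congr' ?_
    filter_upwards [eventually_ge_atTop 0] with u hu using hz_nonneg hu
  · intro ε hε
    obtain ⟨δ, hδ, h⟩ := hslow ε hε
    refine ⟨δ, hδ, fun s hs t ht h1 h2 => ?_⟩
    linarith [h t ht s hs (by linarith) (by linarith)]
  · have := hren_real.neg
    rw [neg_zero] at this
    refine this.congr fun u => ?_
    rw [integral_neg]; ring
  · refine hC.neg.congr fun T => ?_
    rw [← integral_neg]
    simp only [neg_mul]

end CramerLundberg

/-! ### Pathwise link between outage, ladder epochs and the walk -/

section Paths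

variable {Ω : Type*} {A X : ℕ → Ω → ℝ} {p : ℝ}

lemma arrivalCount_eq {ω : Ω} (hA : ∀ i, 0 < A i ω) {n : ℕ} {t : ℝ}
    (h1 : arrivalTime A n ω ≤ t) (h2 : t < arrivalTime A (n + 1) ω) :
    arrivalCount A t ω = n := by
  have hmono : StrictMono fun n => arrivalTime A n ω :=
    strictMono_nat_of_lt_succ fun n => by
      simp only [arrivalTime, Finset.sum_range_succ]
      linarith [hA n]
  have hset : {k : ℕ | 1 ≤ k ∧ arrivalTime A k ω ≤ t} = ↑(Finset.Icc 1 n) := by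
    ext k
    simp only [Set.mem_ofPred_eq, Finset.coe_Icc, Set.mem_Icc]
    refine and_congr_right fun _ => ⟨fun h => ?_, fun h => (hmono.monotone h).trans h1⟩
    exact Nat.lt_succ_iff.1 (hmono.lt_iff_lt.1 (h.trans_lt h2))
  rw [arrivalCount, hset, Set.ncard_coe_finset]
  simp

/-- Outage occurs precisely when the random walk of the increments exceeds the initial energy. -/
lemma outageTime_lt_top_iff {ω : Ω} (hp : 0 < p) (hA : ∀ i, 0 < A i ω)
    (htop : Tendsto (fun n => arrivalTime A n ω) atTop atTop) {u : ℝ} (hu : 0 ≤ u) :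
    outageTime A X p u ω < ⊤ ↔ ω ∈ exceeds (increment A X p) u := by
  have hsum (n : ℕ) : partialSum (increment A X p) n ω =
      p * arrivalTime A n ω - ∑ i ∈ Finset.range n, X i ω := by
    simp only [partialSum, increment, arrivalTime, Finset.sum_sub_distrib, Finset.mul_sum]
  have hlt : outageTime A X p u ω < ⊤ ↔ ∃ t : ℝ, 0 < t ∧ surplus A X p u t ω ≤ 0 := by
    rw [outageTime, sInf_lt_iff]
    constructor
    · rintro ⟨s, ⟨t, h1, h2, -⟩, -⟩
      exact ⟨t, h1, h2⟩
    · rintro ⟨t, h1, h2⟩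
      exact ⟨t, ⟨t, h1, h2, rfl⟩, EReal.coe_lt_top t⟩
  rw [hlt]
  constructor
  · rintro ⟨t, ht, hU⟩
    classical
    have hex : ∃ n, t < arrivalTime A n ω := (htop.eventually (eventually_gt_atTop t)).exists
    obtain ⟨n, hn⟩ : ∃ n, Nat.find hex = n + 1 := by
      refine Nat.exists_eq_succ_of_ne_zero fun h0 => ?_
      have := Nat.find_spec hex
      rw [h0] at this
      simp only [arrivalTime, Finset.range_zero, Finset.sum_empty] at this
      linarith
    have h2 : t < arrivalTime A (n + 1) ω := hn ▸ Nat.find_spec hex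
    have h1 : arrivalTime A n ω ≤ t := not_lt.1 (Nat.find_min hex (by omega))
    rw [surplus, arrivalCount_eq hA h1 h2] at hU
    refine ⟨n + 1, ?_⟩
    rw [hsum]
    -- At time `t` there are `n + 1` packets, counting the one at time `0`. Since `t` precedes the
    -- next arrival strictly, `S_{n+1}` exceeds `u` strictly.
    have := mul_lt_mul_of_pos_left h2 hp
    linarith
  · rintro ⟨n, hn⟩
    rcases n with _ | n
    · rw [partialSum_zero] at hn
      exact absurd hn hu.not_gt
    rw [hsum] at hn
    -- With `n + 1` packets the surplus reaches zero at time `c / p`. Any time after this and after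
    -- arrival `n`, but before arrival `n + 1`, witnesses outage.
    set c := u + ∑ i ∈ Finset.range (n + 1), X i ω with hc
    have hc' : c / p < arrivalTime A (n + 1) ω := by
      rw [div_lt_iff₀ hp]; linarith
    have hn0 : 0 ≤ arrivalTime A n ω := Finset.sum_nonneg fun i _ => (hA i).le
    have hn1 : arrivalTime A n ω < arrivalTime A (n + 1) ω := by
      simp only [arrivalTime, Finset.sum_range_succ]
      linarith [hA n]
    obtain ⟨t, ht1, ht2⟩ := exists_between (max_lt hc' hn1)
    have h1 := (le_max_left _ _).trans_lt ht1
    have h2 := (le_max_right _ _).trans_lt ht1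
    refine ⟨t, hn0.trans_lt h2, ?_⟩
    rw [surplus, arrivalCount_eq hA h2.le ht2]
    rw [div_lt_iff₀ hp] at h1
    linarith

lemma ladderEpoch_eq_of_mem_firstPassage {ω : Ω} {k : ℕ}
    (hω : ω ∈ firstPassage (increment A X p) k) : ladderEpoch A X p ω = k := by
  refine le_antisymm (sInf_le ⟨k, ?_, hω.2, rfl⟩) (le_sInf ?_)
  · rcases k with _ | k
    · rw [firstPassage_zero] at hω
      exact absurd hω (Set.notMem_empty ω)
    · omega
  · rintro _ ⟨n, -, hn, rfl⟩
    rw [Nat.cast_le]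
    by_contra hlt
    exact (hω.1 n (not_le.1 hlt)).not_gt hn

lemma setOf_ladderEpoch_lt_top :
    {ω | ladderEpoch A X p ω < ⊤} = ⋃ k, firstPassage (increment A X p) k := by
  ext ω
  rw [Set.mem_iUnion]
  constructor
  · intro h
    rw [Set.mem_ofPred_eq, ladderEpoch, sInf_lt_iff] at h
    obtain ⟨_, ⟨n, -, hn, -⟩, -⟩ := h
    obtain ⟨k, -, hk⟩ := exists_mem_firstPassage (Z := increment A X p) hn
    exact ⟨k, hk⟩
  · rintro ⟨k, hk⟩
    rw [Set.mem_ofPred_eq, ladderEpoch_eq_of_mem_firstPassage hk]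
    exact ENat.natCast_lt_top k

end Paths

/-! ### Consequences of the model assumptions -/

section Model

/-- It suffices to test measurable rectangles, a generating π-system. There the probability factors
first between the two sequences, then within each, and the factors regroup because `A i` and `X i`
are independent. -/
lemma iIndepFun_prodMk {Ω ι : Type*} [MeasurableSpace Ω] {P : Measure Ω} {A X : ι → Ω → ℝ}
    (hA : ∀ i, Measurable (A i)) (hX : ∀ i, Measurable (X i)) (hAi : iIndepFun A P)
    (hXi : iIndepFun X P) (hAX : IndepFun (fun ω i => A i ω) (fun ω i => X i ω) P) :
    iIndepFun (fun i ω => (A i ω, X i ω)) P := by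
  have hpair (i : ι) : IndepFun (A i) (X i) P :=
    hAX.comp (measurable_pi_apply i) (measurable_pi_apply i)
  rw [iIndepFun_iff_iIndep]
  refine iIndepSets.iIndep (fun i => ((hA i).prodMk (hX i)).comap_le)
    (fun i => Set.preimage (fun ω => (A i ω, X i ω)) ''
      Set.image2 (· ×ˢ ·) {s : Set ℝ | MeasurableSet s} {t : Set ℝ | MeasurableSet t})
    (fun i => isPiSystem_prod.comap _) (fun i => ?_) ?_
  · rw [← MeasurableSpace.comap_generateFrom, generateFrom_prod]
  · rw [iIndepSets_iff]
    intro s f hf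
    have hf' : ∀ i, ∃ B C : Set ℝ, MeasurableSet B ∧ MeasurableSet C ∧
        (i ∈ s → f i = A i ⁻¹' B ∩ X i ⁻¹' C) := by
      intro i
      by_cases hi : i ∈ s
      · obtain ⟨_, ⟨B, hB, C, hC, rfl⟩, h⟩ := hf i hi
        exact ⟨B, C, hB, hC, fun _ => h.symm⟩
      · exact ⟨∅, ∅, MeasurableSet.empty, MeasurableSet.empty, fun h => absurd h hi⟩
    choose B C hB hC hf' using hf'
    have e1 : ⋂ i ∈ s, f i = (fun ω i => A i ω) ⁻¹' (⋂ i ∈ s, (fun a => a i) ⁻¹' B i) ∩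
        (fun ω i => X i ω) ⁻¹' (⋂ i ∈ s, (fun a => a i) ⁻¹' C i) := by
      ext ω
      simp only [Set.mem_iInter, Set.mem_inter_iff, Set.mem_preimage]
      constructor
      · intro h
        have h' : ∀ i ∈ s, A i ω ∈ B i ∧ X i ω ∈ C i := by
          intro i hi
          have := h i hi
          rw [hf' i hi] at this
          exact this
        exact ⟨fun i hi => (h' i hi).1, fun i hi => (h' i hi).2⟩
      · rintro ⟨h1, h2⟩ i hi
        rw [hf' i hi]
        exact ⟨h1 i hi, h2 i hi⟩
    have hBm : MeasurableSet (⋂ i ∈ s, (fun a : ι → ℝ => a i) ⁻¹' B i) :=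
      Finset.measurableSet_biInter s fun i _ => measurable_pi_apply i (hB i)
    have hCm : MeasurableSet (⋂ i ∈ s, (fun a : ι → ℝ => a i) ⁻¹' C i) :=
      Finset.measurableSet_biInter s fun i _ => measurable_pi_apply i (hC i)
    rw [e1, hAX.measure_inter_preimage_eq_mul _ _ hBm hCm, Set.preimage_iInter₂,
      Set.preimage_iInter₂]
    have e2 := hAi.measure_inter_preimage_eq_mul s (sets := B) fun i _ => hB i
    have e3 := hXi.measure_inter_preimage_eq_mul s (sets := C) fun i _ => hC i
    refine (congrArg₂ (· * ·) e2 e3).trans ?_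
    rw [← Finset.prod_mul_distrib]
    refine Finset.prod_congr rfl fun i hi => ?_
    rw [hf' i hi, (hpair i).measure_inter_preimage_eq_mul _ _ (hB i) (hC i)]

variable {Ω : Type*} [MeasurableSpace Ω] {P : Measure Ω} {A X : ℕ → Ω → ℝ} {p : ℝ}

lemma IsModel.measurable_increment (h : IsModel P A X p) (i : ℕ) :
    Measurable (increment A X p i) :=
  ((h.measurable_A i).const_mul p).sub (h.measurable_X i)

lemma IsModel.iIndepFun_increment (h : IsModel P A X p) : iIndepFun (increment A X p) P :=
  (iIndepFun_prodMk h.measurable_A h.measurable_X h.indep_A h.indep_X h.indep_A_X).comp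
    (fun _ q => p * q.1 - q.2) fun _ => by fun_prop

lemma IsModel.indepFun_A_X (h : IsModel P A X p) (i : ℕ) : IndepFun (A i) (X i) P :=
  h.indep_A_X.comp (measurable_pi_apply i) (measurable_pi_apply i)

lemma IsModel.identDistrib_increment [IsProbabilityMeasure P] (h : IsModel P A X p) (i : ℕ) :
    IdentDistrib (increment A X p i) (increment A X p 0) P P :=
  ((h.ident_A i).prodMk (h.ident_X i) (h.indepFun_A_X i) (h.indepFun_A_X 0)).comp
    (by fun_prop : Measurable fun q : ℝ × ℝ => p * q.1 - q.2)

lemma IsModel.integrable_increment (h : IsModel P A X p) :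
    Integrable (increment A X p 0) P :=
  (h.integrable_A.const_mul p).sub h.integrable_X

lemma IsModel.ae_pos_A (h : IsModel P A X p) : ∀ᵐ ω ∂P, ∀ i, 0 < A i ω := by
  rw [ae_all_iff]
  intro i
  rw [ae_iff]
  simpa only [not_lt] using h.pos_A i

lemma IsModel.integral_A_pos [IsProbabilityMeasure P] (h : IsModel P A X p) :
    0 < ∫ ω, A 0 ω ∂P := by
  have hae : ∀ᵐ ω ∂P, 0 < A 0 ω := h.ae_pos_A.mono fun ω hω => hω 0
  rw [integral_pos_iff_support_of_nonneg_ae (hae.mono fun ω hω => hω.le) h.integrable_A]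
  rw [pos_iff_ne_zero]
  intro h0
  have hfalse : ∀ᵐ ω ∂P, False := by
    have h0' : ∀ᵐ ω ∂P, ω ∉ Function.support (A 0) := measure_eq_zero_iff_ae_notMem.1 h0
    filter_upwards [hae, h0'] with ω h1 h2
    exact h2 h1.ne'
  exact hfalse.exists.elim fun _ h => h

lemma IsModel.integral_increment_neg [IsProbabilityMeasure P] (h : IsModel P A X p)
    (hs : SelfSustainable P A X p) : ∫ ω, increment A X p 0 ω ∂P < 0 := by
  have hpos := h.integral_A_pos
  have e : ∫ ω, increment A X p 0 ω ∂P = p * ∫ ω, A 0 ω ∂P - ∫ ω, X 0 ω ∂P := by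
    simp only [increment]
    rw [integral_sub (h.integrable_A.const_mul p) h.integrable_X, integral_const_mul]
  rw [SelfSustainable, arrivalRate, one_div, inv_mul_eq_div, lt_div_iff₀ hpos] at hs
  rw [e]
  linarith

/-- By the strong law `S_n / n` has a negative limit. -/
lemma IsModel.ae_tendsto_walk [IsProbabilityMeasure P] (h : IsModel P A X p)
    (hs : SelfSustainable P A X p) :
    ∀ᵐ ω ∂P, Tendsto (fun n => partialSum (increment A X p) n ω) atTop atBot := by
  filter_upwards [strong_law_ae_real (increment A X p) h.integrable_increment
    (fun i j hij => h.iIndepFun_increment.indepFun hij) h.identDistrib_increment] with ω hω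
  have h1 := hω.neg_mul_atTop (h.integral_increment_neg hs)
    (tendsto_natCast_atTop_atTop (R := ℝ))
  refine h1.congr' ?_
  filter_upwards [eventually_gt_atTop 0] with n hn
  rw [div_mul_cancel₀ _ (by exact_mod_cast hn.ne')]
  rfl

lemma IsModel.ae_tendsto_arrivalTime [IsProbabilityMeasure P] (h : IsModel P A X p) :
    ∀ᵐ ω ∂P, Tendsto (fun n => arrivalTime A n ω) atTop atTop := by
  filter_upwards [strong_law_ae_real A h.integrable_A
    (fun i j hij => h.indep_A.indepFun hij) h.ident_A] with ω hω
  have h1 := hω.pos_mul_atTop h.integral_A_pos (tendsto_natCast_atTop_atTop (R := ℝ))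
  refine h1.congr' ?_
  filter_upwards [eventually_gt_atTop 0] with n hn
  rw [div_mul_cancel₀ _ (by exact_mod_cast hn.ne')]
  rfl

/-- The events agree almost surely, so measurability of the outage event is not needed. -/
lemma IsModel.outageProb_eq [IsProbabilityMeasure P] (h : IsModel P A X p) {u : ℝ} (hu : 0 ≤ u) :
    outageProb P A X p u = (P (exceeds (increment A X p) u)).toReal := by
  rw [outageProb, measureReal_def]
  congr 1
  refine measure_congr ?_
  filter_upwards [h.ae_pos_A, h.ae_tendsto_arrivalTime] with ω h1 h2
  exact propext (outageTime_lt_top_iff h.rate_pos h1 h2 hu)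

/-- On each first-passage event the height agrees with a measurable partial sum, so almost
everywhere measurability there suffices; the default value off `{σ < ∞}` plays no role. -/
lemma IsModel.ladderHeightLaw_eq (h : IsModel P A X p) :
    ladderHeightLaw P A X p = heightLaw P (increment A X p) := by
  have hms := measurableSet_firstPassage h.measurable_increment
  have hae (k : ℕ) : ladderHeight A X p =ᵐ[P.restrict (firstPassage (increment A X p) k)]
      partialSum (increment A X p) k := by
    filter_upwards [ae_restrict_mem (hms k)] with ω hω
    rw [ladderHeight, ladderEpoch_eq_of_mem_firstPassage hω, ENat.toNat_natCast]
    rfl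
  have hm (k : ℕ) : AEMeasurable (ladderHeight A X p)
      (P.restrict (firstPassage (increment A X p) k)) :=
    (measurable_partialSum h.measurable_increment k).aemeasurable.congr (hae k).symm
  rw [ladderHeightLaw, setOf_ladderEpoch_lt_top,
    Measure.restrict_iUnion (pairwise_disjoint_firstPassage _) hms,
    Measure.map_sum (aemeasurable_sum_measure_iff.2 hm), heightLaw]
  congr 1
  funext k
  exact Measure.map_congr (hae k)

/-- A set whose reflected translates are null for the packet size is null for the ladder
height. -/
lemma IsModel.ladderHeightLaw_null [IsProbabilityMeasure P] (h : IsModel P A X p) {N : Set ℝ}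
    (hN : MeasurableSet N) (hnull : ∀ y, P {ω | y - X 0 ω ∈ N} = 0) :
    ladderHeightLaw P A X p N = 0 := by
  rw [h.ladderHeightLaw_eq]
  refine heightLaw_eq_zero_of_forall_translate h.measurable_increment h.iIndepFun_increment
    h.identDistrib_increment hN fun y => ?_
  have hA := h.measurable_A 0
  have hX := h.measurable_X 0
  have hset : MeasurableSet {q : ℝ × ℝ | y + (p * q.1 - q.2) ∈ N} :=
    (by fun_prop : Measurable fun q : ℝ × ℝ => y + (p * q.1 - q.2)) hN
  have hmap := (indepFun_iff_map_prod_eq_prod_map_map hA.aemeasurable hX.aemeasurable).1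
    (h.indepFun_A_X 0)
  have : IsProbabilityMeasure (P.map (X 0)) := Measure.isProbabilityMeasure_map hX.aemeasurable
  have e : P {ω | y + increment A X p 0 ω ∈ N} =
      P.map (fun ω => (A 0 ω, X 0 ω)) {q : ℝ × ℝ | y + (p * q.1 - q.2) ∈ N} :=
    (Measure.map_apply (hA.prodMk hX) hset).symm
  -- Freezing `A 0 = a` by independence leaves the reflected translate with parameter `y + p * a`.
  rw [e, hmap, Measure.prod_apply hset]
  refine (lintegral_congr fun a => ?_).trans lintegral_zero
  rw [Measure.map_apply hX (measurable_prodMk_left hset)]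
  refine Eq.trans (congrArg P ?_) (hnull (y + p * a))
  ext ω
  simp only [Set.mem_preimage, Set.mem_ofPred_eq, add_sub_assoc]

lemma IsModel.nullSingletonClass_ladderHeightLaw [IsProbabilityMeasure P]
    (h : IsModel P A X p) : NullSingletonClass (ladderHeightLaw P A X p) := by
  refine ⟨fun x => h.ladderHeightLaw_null (measurableSet_singleton x) fun y => ?_⟩
  refine measure_mono_null (fun ω hω => ?_) (h.continuous_X (y - x))
  have hω' : y - X 0 ω = x := hω
  change X 0 ω = y - x
  linarith

lemma IsModel.ladderHeightLaw_absolutelyContinuous [IsProbabilityMeasure P]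
    (h : IsModel P A X p) (hX : (P.map (X 0)).AbsolutelyContinuous volume) :
    (ladderHeightLaw P A X p).AbsolutelyContinuous volume := by
  refine Measure.AbsolutelyContinuous.mk fun N hN hvol => ?_
  refine h.ladderHeightLaw_null hN fun y => ?_
  have hm : MeasurableSet ((fun x => y - x) ⁻¹' N) := (measurable_const.sub measurable_id) hN
  have h0 : volume ((fun x => y - x) ⁻¹' N) = 0 := by
    rw [(Measure.measurePreserving_sub_left volume y).measure_preimage hN.nullMeasurableSet, hvol]
  have := hX h0
  rwa [Measure.map_apply (h.measurable_X 0) hm] at this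

end Model

end

end HSC

/-! ### The main theorem -/

theorem mainTheorem4 {Ω : Type*} [MeasurableSpace Ω]
    (P : MeasureTheory.Measure Ω) [MeasureTheory.IsProbabilityMeasure P]
    (A X : ℕ → Ω → ℝ) (p : ℝ)
    (hmodel : HSC.IsModel P A X p) (hsus : HSC.SelfSustainable P A X p) :
    -- the asymptotic formula
    (∀ r : ℝ, HSC.IsAdjustmentCoefficient (HSC.ladderHeightLaw P A X p) r →
      MeasureTheory.Integrable (fun x : ℝ => x * Real.exp (r * x)) (HSC.ladderHeightLaw P A X p) →
      Asymptotics.IsEquivalent Filter.atTop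
        (fun u₀ : ℝ => HSC.outageProb P A X p u₀)
        (fun u₀ : ℝ => (1 - HSC.ladderMass P A X p) / (r * HSC.tiltedMean P A X p r)
          * Real.exp (-r * u₀))) ∧
    -- if the packet size has a density, so has `H`, and the constant is `∫ x e^{r x} f_H(x) dx`
    ((P.map (X 0)).AbsolutelyContinuous MeasureTheory.volume →
      (HSC.ladderHeightLaw P A X p).AbsolutelyContinuous MeasureTheory.volume ∧
      ∀ r : ℝ, HSC.tiltedMean P A X p r =
        ∫ x : ℝ, x * Real.exp (r * x) * HSC.ladderHeightDensity P A X p x) ∧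
    -- the adjustment coefficients of `H` and of `Z` coincide
    (∀ r : ℝ, HSC.IsAdjustmentCoefficient (HSC.ladderHeightLaw P A X p) r ↔
      HSC.IsAdjustmentCoefficient (P.map (HSC.increment A X p 0)) r) := by
  have hZ := hmodel.measurable_increment
  have hI := hmodel.iIndepFun_increment
  have hid := hmodel.identDistrib_increment
  have hdrift := hmodel.ae_tendsto_walk hsus
  have hlaw := hmodel.ladderHeightLaw_eq
  have hfin : MeasureTheory.IsFiniteMeasure (HSC.ladderHeightLaw P A X p) :=
    hlaw ▸ HSC.isFiniteMeasure_heightLaw hZ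
  have h0 : HSC.ladderHeightLaw P A X p (Set.Iic 0) = 0 := hlaw ▸ HSC.heightLaw_Iic_zero hZ
  have hlt : HSC.ladderHeightLaw P A X p Set.univ < 1 :=
    hlaw ▸ HSC.heightLaw_univ_lt_one hZ hI hid hdrift
  refine ⟨fun r hr hint => ?_, fun hX => ⟨?_, fun r => ?_⟩, fun r => ?_⟩
  · have hrpos := hr.pos_of_defective h0 hlt
    have hna := hmodel.nullSingletonClass_ladderHeightLaw
    obtain ⟨hmean, hlim⟩ := HSC.tendsto_exp_mul_of_defective_renewal
      (ψ := fun u => P (HSC.exceeds (HSC.increment A X p) u)) h0 hrpos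
      (HSC.isAdjustmentCoefficient_iff_lintegral.1 hr).2 hint
      (fun _ _ h => MeasureTheory.measure_mono (HSC.exceeds_antitone _ h))
      (fun u => MeasureTheory.prob_le_one)
      (fun u hu => by rw [HSC.exceeds_of_neg _ hu, MeasureTheory.measure_univ])
      (fun u hu => by rw [hlaw]; exact HSC.measure_exceeds_eq_lintegral hZ hI hid hu)
    have hmass : HSC.ladderMass P A X p < 1 := by
      have := (ENNReal.toReal_lt_toReal hlt.ne_top ENNReal.one_ne_top).2 hlt
      rwa [ENNReal.toReal_one] at this
    set c := (1 - HSC.ladderMass P A X p) / (r * HSC.tiltedMean P A X p r) with hc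
    have hcpos : 0 < c := div_pos (sub_pos.2 hmass) (mul_pos hrpos hmean)
    -- Since `c > 0`, the limit of `e^{ru} ψ(u)` divided by `c` is the required ratio limit `1`.
    refine Asymptotics.isEquivalent_of_tendsto_one ?_
    have hdiv := hlim.div_const c
    have hcc : (1 - (HSC.ladderHeightLaw P A X p).real Set.univ) /
        (r * ∫ x, x * Real.exp (r * x) ∂HSC.ladderHeightLaw P A X p) / c = 1 :=
      div_self hcpos.ne'
    rw [hcc] at hdiv
    refine hdiv.congr' ?_
    filter_upwards [Filter.eventually_ge_atTop 0] with u hu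
    rw [Pi.div_apply, hmodel.outageProb_eq hu, neg_mul, Real.exp_neg]
    field_simp
  · exact hmodel.ladderHeightLaw_absolutelyContinuous hX
  · rw [HSC.tiltedMean, ← MeasureTheory.integral_rnDeriv_smul
      (hmodel.ladderHeightLaw_absolutelyContinuous hX)]
    simp only [HSC.ladderHeightDensity, smul_eq_mul, mul_comm]
  · have hprob : MeasureTheory.IsProbabilityMeasure (P.map (HSC.increment A X p 0)) :=
      MeasureTheory.Measure.isProbabilityMeasure_map (hZ 0).aemeasurable
    have key {r : ℝ} (hr : 0 < r) : HSC.IsAdjustmentCoefficient (HSC.ladderHeightLaw P A X p) r ↔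
        HSC.IsAdjustmentCoefficient (P.map (HSC.increment A X p 0)) r := by
      rw [HSC.isAdjustmentCoefficient_iff_lintegral, HSC.isAdjustmentCoefficient_iff_lintegral,
        hlaw, HSC.lintegral_exp_heightLaw_eq_one_iff hZ hI hid hdrift hr,
        MeasureTheory.lintegral_map (by fun_prop) (hZ 0)]
    -- Either property forces `r > 0`: the ladder law is defective on the positive half-line, and
    -- the increment has negative mean.
    refine ⟨fun h => (key (h.pos_of_defective h0 hlt)).1 h, fun h => (key ?_).2 h⟩
    refine h.pos_of_integral_neg ?_ ?_
    · exact (MeasureTheory.integrable_map_measure (by fun_prop) (hZ 0).aemeasurable).2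
        hmodel.integrable_increment
    · rw [MeasureTheory.integral_map (hZ 0).aemeasurable (by fun_prop)]
      exact hmodel.integral_increment_neg hsus
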